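/- Let $X$ be the graph with vertex set $\mathbb{Z}^2$ in which two vertices are adjacent if and only if their $\ell_1$-distance is $1$. For $A\subset\mathbb{Z}^2$ let $\partial A$ be its vertex boundary, the set of vertices not in $A$ that are adjacent to a vertex of $A$. A finite set $A\subset\mathbb{Z}^2$ is minimal if $|\partial A|\le|\partial B|$ for every $B\subset\mathbb{Z}^2$ with $|B|=|A|$. The life expectancy of a minimal set $A$ is the maximum, in $\mathbb{N}\cup\{\infty\}$, of all $n$ for which there is a nested sequence $A=A_0\subset A_1\subset\dots\subset A_n$ of minimal sets with $|A_i|=|A|+i$ (it is $\infty$ if such $n$ are unbounded). A minimal set is mortal if its life expectancy is finite, and dead if its life expectancy is $0$. A box is a nonempty set of the form $\{(x,y)\in\mathbb{Z}^2 \mid a\le y-x\le b,\ c\le y+x\le d\}$ with $a,b,c,d\in\mathbb{Z}$, and the enclosing box $\mathrm{enc}(A)$ of a nonempty finite set $A$ is the smallest box containing $A$. Theorem. Let $A\subset\mathbb{Z}^2$ be a nonempty minimal set. Then $\mathrm{enc}(A)$ is minimal, and $A$ is mortal if and only if $\mathrm{enc}(A)$ is dead. -/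

import Mathlib

namespace PlanarIso

/-- The graph `X` on `ℤ²`, two vertices being adjacent when their `ℓ₁`-distance is one. -/
def latticeGraph : SimpleGraph (ℤ × ℤ) where
  Adj u v := |u.1 - v.1| + |u.2 - v.2| = 1
  symm := ⟨fun u v h => by rw [abs_sub_comm v.1, abs_sub_comm v.2]; exact h⟩
  loopless := ⟨fun u h => by simp at h⟩

/-- The vertex boundary `∂A`: vertices outside `A` that are adjacent to a vertex of `A`. -/
def vertexBoundary (A : Set (ℤ × ℤ)) : Set (ℤ × ℤ) :=
  {u | u ∉ A ∧ ∃ v ∈ A, latticeGraph.Adj u v}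

/-- A finite set of vertices is minimal if its vertex boundary has the smallest size among all
sets with the same number of vertices. -/
def IsMinimal (A : Set (ℤ × ℤ)) : Prop :=
  A.Finite ∧ ∀ B : Set (ℤ × ℤ), B.Finite → B.ncard = A.ncard →
    (vertexBoundary A).ncard ≤ (vertexBoundary B).ncard

/-- The set `B(a,b,c,d)` bounded by lines of slope `1` and `-1`. -/
def boxSet (a b c d : ℤ) : Set (ℤ × ℤ) :=
  {p | a ≤ p.2 - p.1 ∧ p.2 - p.1 ≤ b ∧ c ≤ p.2 + p.1 ∧ p.2 + p.1 ≤ d}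

/-- A box is a nonempty set of the form `B(a,b,c,d)`. -/
def IsBox (B : Set (ℤ × ℤ)) : Prop :=
  B.Nonempty ∧ ∃ a b c d : ℤ, B = boxSet a b c d

/-- The enclosing box, as the intersection of all boxes containing `A`. For finite nonempty `A`
it is the smallest box containing `A`, see `isLeast_enc`. -/
def enc (A : Set (ℤ × ℤ)) : Set (ℤ × ℤ) :=
  ⋂₀ {B | IsBox B ∧ A ⊆ B}

theorem isLeast_enc {A : Set (ℤ × ℤ)} (hA : A.Finite) (hne : A.Nonempty) :
    IsLeast {B | IsBox B ∧ A ⊆ B} (enc A) := by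
  obtain ⟨p, hp, hp'⟩ := Set.exists_min_image A (fun q => q.2 - q.1) hA hne
  obtain ⟨q, hq, hq'⟩ := Set.exists_max_image A (fun q => q.2 - q.1) hA hne
  obtain ⟨r, hr, hr'⟩ := Set.exists_min_image A (fun q => q.2 + q.1) hA hne
  obtain ⟨s, hs, hs'⟩ := Set.exists_max_image A (fun q => q.2 + q.1) hA hne
  have hsub : A ⊆ boxSet (p.2 - p.1) (q.2 - q.1) (r.2 + r.1) (s.2 + s.1) :=
    fun t ht => ⟨hp' t ht, hq' t ht, hr' t ht, hs' t ht⟩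
  have hbox : IsBox (boxSet (p.2 - p.1) (q.2 - q.1) (r.2 + r.1) (s.2 + s.1)) :=
    ⟨hne.mono hsub, _, _, _, _, rfl⟩
  have heq : enc A = boxSet (p.2 - p.1) (q.2 - q.1) (r.2 + r.1) (s.2 + s.1) := by
    apply Set.Subset.antisymm
    · exact Set.sInter_subset_of_mem ⟨hbox, hsub⟩
    · rintro t ⟨h1, h2, h3, h4⟩ B ⟨⟨-, a, b, c, d, rfl⟩, hAB⟩
      exact ⟨(hAB hp).1.trans h1, h2.trans (hAB hq).2.1, (hAB hr).2.2.1.trans h3,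
        h4.trans (hAB hs).2.2.2⟩
  exact ⟨heq ▸ ⟨hbox, hsub⟩, fun B hB => Set.sInter_subset_of_mem hB⟩

/-- There is a nested sequence `A = S 0 ⊆ S 1 ⊆ ⋯ ⊆ S n` of minimal sets with
`|S i| = |A| + i`. -/
def HasMinimalChain (A : Set (ℤ × ℤ)) (n : ℕ) : Prop :=
  ∃ S : ℕ → Set (ℤ × ℤ), S 0 = A ∧
    (∀ i ≤ n, IsMinimal (S i) ∧ (S i).ncard = A.ncard + i) ∧
    ∀ i < n, S i ⊆ S (i + 1)

/-- The life expectancy of a minimal set: the largest `n` for which there is a nested sequence of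
minimal sets as above, and `∞` if there is no largest one. -/
noncomputable def lifeExpectancy (A : Set (ℤ × ℤ)) : ℕ∞ :=
  ⨆ n ∈ {n : ℕ | HasMinimalChain A n}, (n : ℕ∞)

/-- A minimal set of finite life expectancy. -/
def IsMortal (A : Set (ℤ × ℤ)) : Prop :=
  IsMinimal A ∧ lifeExpectancy A < ⊤

/-- A minimal set of life expectancy zero. -/
def IsDead (A : Set (ℤ × ℤ)) : Prop :=
  IsMinimal A ∧ lifeExpectancy A = 0

end PlanarIso

/-! In the coordinates `(y - x, y + x)` the graph becomes the set of integer points with even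
coordinate sum, joined to their diagonal neighbours, and boxes become rectangles `rect a b c d`.
Minimality is studied there (`MinF`) and carried back by `pts`.

The lattice splits into the points in even and in odd columns, and all neighbours of one class lie
in the other. A nonempty set has at least `|S| + columns + rows + 1` neighbours (`card_nb`). Adding
this over the two classes `E`, `O` of `S`, when both are nonempty, the cardinalities cancel and `bd
S ≥ span E + span O + 2`. Since `4|E| ≤ (span E)²` and likewise for `O`, this gives the
isoperimetric inequality `|S| ≤ maxSize (bd S - 2)`, attained by nearly square rectangles. The
arithmetic has one unit of slack, so for a minimal set meeting both classes every inequality used is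
an equality (`MinF.card_nb_evens`). This makes the set convex along lines (`Tight`) and its boundary
depends only on its bounding rectangle (`MinF.bd_eq`). Minimal sets in a single class have at most
two points and already fill their rectangle.

A tight set without empty rows that does not fill its rectangle has a missing point there whose
insertion does not enlarge the boundary (`Tight.exists_insert`). As the least possible boundary is
monotone in the cardinality, the enlarged set is again minimal. Hence minimal sets grow up to their
rectangle, which is therefore minimal.

If a chain leaves the rectangle by a point `x`, submodularity of `bd` shows that `x` also extends
the full rectangle (`MinF.insert_boundingRect`). So a dead enclosing box confines every chain, whose
length is then bounded. Conversely, an extendable rectangle has the largest cardinality for its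
half-perimeter. It can be extended so that the next rectangle again has enough points to be
extendable (`exists_insert_rect_not_dead`). Extendability of the enclosing box is thus an invariant
that can be kept forever. -/

namespace PlanarIso

/-! ### Arithmetic of the extremal function. -/

/-- The largest number of lattice points in a box whose two side lengths (counted in diagonals)
add up to `s`. -/
def maxSize (s : ℕ) : ℕ := (s * s / 4 + 1) / 2

theorem maxSize_even (t : ℕ) : maxSize (2 * t) = (t * t + 1) / 2 := by
  unfold maxSize
  have : 2 * t * (2 * t) = 4 * (t * t) := by ring
  omega

theorem maxSize_odd (t : ℕ) : maxSize (2 * t + 1) = t * (t + 1) / 2 := by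
  unfold maxSize
  have h1 : (2 * t + 1) * (2 * t + 1) = 4 * (t * (t + 1)) + 1 := by ring
  have h2 : t * (t + 1) % 2 = 0 := Nat.even_iff.1 (Nat.even_mul_succ_self t)
  omega

theorem maxSize_mono : Monotone maxSize := by
  intro s t h
  unfold maxSize
  have : s * s ≤ t * t := Nat.mul_le_mul h h
  omega

/-- Here `e`, `o` stand for the sizes of the two classes and `x`, `y` for their spans. The square
bounds suffice unless the spans are far apart; then `h1`, which limits the imbalance of the classes,
takes over. -/
theorem le_maxSize_aux {e o x y s : ℕ} (hxy : y ≤ x) (ho : 1 ≤ o)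
    (hex : 4 * e ≤ x * x) (hoy : 4 * o ≤ y * y) (hs : x + y ≤ s) (h1 : e + x ≤ o + s + 2) :
    e + o ≤ maxSize s := by
  have hy : 2 ≤ y := by
    by_contra h
    have : y = 0 ∨ y = 1 := by omega
    rcases this with rfl | rfl <;> omega
  have hyx : y * y ≤ x * x := Nat.mul_le_mul hxy hxy
  by_cases hc : 2 * x ≤ s
  · refine le_trans ?_ (maxSize_mono hc)
    rw [maxSize_even]
    rcases Nat.even_or_odd' x with ⟨k, rfl | rfl⟩
    · have : 2 * k * (2 * k) = 4 * (k * k) := by ring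
      omega
    · have : (2 * k + 1) * (2 * k + 1) = 4 * (k * k) + 4 * k + 1 := by ring
      omega
  · obtain ⟨z, rfl⟩ : ∃ z, s = x + z := ⟨s - x, by omega⟩
    have hz : y * y ≤ z * z := Nat.mul_le_mul (by omega) (by omega)
    obtain ⟨j, rfl⟩ : ∃ j, x = z + 1 + j := ⟨x - z - 1, by omega⟩
    rcases j with _ | _ | j
    · have : z + 1 + 0 + z = 2 * z + 1 := by ring
      rw [this, maxSize_odd]
      rcases Nat.even_or_odd' z with ⟨k, rfl | rfl⟩
      · have e1 : 2 * k * (2 * k) = 4 * (k * k) := by ring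
        have e2 : (2 * k + 1 + 0) * (2 * k + 1 + 0) = 4 * (k * k) + 4 * k + 1 := by ring
        have e3 : 2 * k * (2 * k + 1) = 4 * (k * k) + 2 * k := by ring
        omega
      · have e1 : (2 * k + 1) * (2 * k + 1) = 4 * (k * k) + 4 * k + 1 := by ring
        have e2 : (2 * k + 1 + 1 + 0) * (2 * k + 1 + 1 + 0) = 4 * (k * k) + 8 * k + 4 := by ring
        have e3 : (2 * k + 1) * (2 * k + 1 + 1) = 4 * (k * k) + 6 * k + 2 := by ring
        omega
    · have : z + 1 + (0 + 1) + z = 2 * (z + 1) := by ring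
      rw [this, maxSize_even]
      rcases Nat.even_or_odd' z with ⟨k, rfl | rfl⟩
      · have e1 : 2 * k * (2 * k) = 4 * (k * k) := by ring
        have e2 : (2 * k + 1 + (0 + 1)) * (2 * k + 1 + (0 + 1)) = 4 * (k * k) + 8 * k + 4 := by
          ring
        have e3 : (2 * k + 1) * (2 * k + 1) = 4 * (k * k) + 4 * k + 1 := by ring
        omega
      · have e1 : (2 * k + 1) * (2 * k + 1) = 4 * (k * k) + 4 * k + 1 := by ring
        have e2 : (2 * k + 1 + 1 + (0 + 1)) * (2 * k + 1 + 1 + (0 + 1)) =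
          4 * (k * k) + 12 * k + 9 := by ring
        have e3 : (2 * k + 1 + 1) * (2 * k + 1 + 1) = 4 * (k * k) + 8 * k + 4 := by ring
        omega
    -- Now `x ≥ z + 3`, so the square bound on `e` is useless. Instead `h1` reads `e ≤ o + z + 2`,
    -- and `4 * o ≤ z * z`.
    · refine le_trans ?_ (maxSize_mono (by omega : 2 * (z + 1) + 1 ≤ z + 1 + (j + 1 + 1) + z))
      rw [maxSize_odd]
      have e1 : (z + 1) * (z + 1 + 1) = z * z + 3 * z + 2 := by ring
      omega

theorem le_maxSize {e o x y s : ℕ} (he : 1 ≤ e) (ho : 1 ≤ o)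
    (hex : 4 * e ≤ x * x) (hoy : 4 * o ≤ y * y) (hs : x + y ≤ s) (h1 : e + x ≤ o + s + 2)
    (h2 : o + y ≤ e + s + 2) : e + o ≤ maxSize s := by
  rcases le_total y x with h | h
  · exact le_maxSize_aux h ho hex hoy hs h1
  · rw [add_comm]
    exact le_maxSize_aux h he hoy hex (by omega) h2

theorem two_le_of_four_mul_le_sq {e x : ℕ} (he : 1 ≤ e) (hex : 4 * e ≤ x * x) : 2 ≤ x := by
  by_contra h
  have : x * x ≤ 1 * 1 := Nat.mul_le_mul (by omega) (by omega)
  omega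

theorem le_maxSize_single {e x s : ℕ} (he : 1 ≤ e) (hex : 4 * e ≤ x * x) (hs : e + x ≤ s + 1) :
    e ≤ maxSize s := by
  have hx := two_le_of_four_mul_le_sq he hex
  rcases lt_or_ge e 3 with h | h
  · interval_cases e
    · exact (maxSize_mono (by omega : 2 ≤ s))
    · have : 3 ≤ x := by
        by_contra h
        have : x * x ≤ 2 * 2 := Nat.mul_le_mul (by omega) (by omega)
        omega
      exact (maxSize_mono (by omega : 4 ≤ s))
  · have hx : 4 ≤ x := by
      by_contra h
      have : x * x ≤ 3 * 3 := Nat.mul_le_mul (by omega) (by omega)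
      omega
    refine le_trans ?_ (maxSize_mono (by omega : e + 3 ≤ s))
    unfold maxSize
    have : 8 * e + 1 ≤ (e + 3) * (e + 3) := by nlinarith
    omega

theorem le_maxSize_single' {e x s : ℕ} (he : 3 ≤ e) (hex : 4 * e ≤ x * x) (hs : e + x ≤ s + 2) :
    e ≤ maxSize s := by
  have hx : 4 ≤ x := by
    by_contra h
    have : x * x ≤ 3 * 3 := Nat.mul_le_mul (by omega) (by omega)
    omega
  refine le_trans ?_ (maxSize_mono (by omega : e + 2 ≤ s))
  unfold maxSize
  obtain ⟨k, rfl⟩ : ∃ k, e = k + 3 := ⟨e - 3, by omega⟩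
  have : (k + 3 + 2) * (k + 3 + 2) = k * k + 10 * k + 25 := by ring
  have : 0 ≤ k * k := Nat.zero_le _
  omega

theorem maxSize_succ_le_of_even {s b : ℕ} (hs : s % 2 = 0) (h : s ≤ 2 * b) :
    maxSize (s + 1) ≤ maxSize s + b / 2 := by
  obtain ⟨t, rfl⟩ : ∃ t, s = 2 * t := ⟨s / 2, by omega⟩
  rw [maxSize_odd, maxSize_even, mul_add, mul_one]
  omega

theorem maxSize_succ_le_of_odd {s b : ℕ} (hs : s % 2 = 1) (h : s ≤ 2 * b) :
    maxSize (s + 1) ≤ maxSize s + (b + 1) / 2 := by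
  obtain ⟨t, rfl⟩ : ∃ t, s = 2 * t + 1 := ⟨s / 2, by omega⟩
  have h1 : 2 * t + 1 + 1 = 2 * (t + 1) := by ring
  rw [h1, maxSize_odd, maxSize_even]
  have h2 : (t + 1) * (t + 1) = t * (t + 1) + t + 1 := by ring
  have h3 : t * (t + 1) % 2 = 0 := Nat.even_iff.1 (Nat.even_mul_succ_self t)
  omega

/-! ### Lower bound for the number of diagonal neighbours, and its equality case. -/

/-- The union of the translates of `T` by one step to the left and one step to the right. -/
def hdbl (T : Finset (ℤ × ℤ)) : Finset (ℤ × ℤ) :=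
  T.image (fun p => (p.1 + 1, p.2)) ∪ T.image (fun p => (p.1 - 1, p.2))

/-- The union of the translates of `T` by one step up and one step down. -/
def vdbl (T : Finset (ℤ × ℤ)) : Finset (ℤ × ℤ) :=
  T.image (fun p => (p.1, p.2 + 1)) ∪ T.image (fun p => (p.1, p.2 - 1))

/-- The set of diagonal neighbours of the points of `S`. -/
def nb (S : Finset (ℤ × ℤ)) : Finset (ℤ × ℤ) := hdbl (vdbl S)

theorem mem_hdbl {T : Finset (ℤ × ℤ)} {u v : ℤ} :
    (u, v) ∈ hdbl T ↔ (u - 1, v) ∈ T ∨ (u + 1, v) ∈ T := by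
  simp only [hdbl, Finset.mem_union, Finset.mem_image, Prod.mk.injEq, Prod.exists]
  constructor
  · rintro (⟨a, b, h, rfl, rfl⟩ | ⟨a, b, h, rfl, rfl⟩)
    · left; simpa using h
    · right; simpa using h
  · rintro (h | h)
    · exact Or.inl ⟨_, _, h, by ring, rfl⟩
    · exact Or.inr ⟨_, _, h, by ring, rfl⟩

theorem mem_vdbl {T : Finset (ℤ × ℤ)} {u v : ℤ} :
    (u, v) ∈ vdbl T ↔ (u, v - 1) ∈ T ∨ (u, v + 1) ∈ T := by
  simp only [vdbl, Finset.mem_union, Finset.mem_image, Prod.mk.injEq, Prod.exists]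
  constructor
  · rintro (⟨a, b, h, rfl, rfl⟩ | ⟨a, b, h, rfl, rfl⟩)
    · left; simpa using h
    · right; simpa using h
  · rintro (h | h)
    · exact Or.inl ⟨_, _, h, rfl, by ring⟩
    · exact Or.inr ⟨_, _, h, rfl, by ring⟩

theorem mem_nb {S : Finset (ℤ × ℤ)} {u v : ℤ} :
    (u, v) ∈ nb S ↔ ((u - 1, v - 1) ∈ S ∨ (u - 1, v + 1) ∈ S) ∨
      (u + 1, v - 1) ∈ S ∨ (u + 1, v + 1) ∈ S := by
  simp only [nb, mem_hdbl, mem_vdbl]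

theorem mem_image_swap {S : Finset (ℤ × ℤ)} {u v : ℤ} :
    (u, v) ∈ S.image Prod.swap ↔ (v, u) ∈ S := by
  simp only [Finset.mem_image, Prod.exists, Prod.swap_prod_mk, Prod.mk.injEq]
  exact ⟨fun ⟨a, b, h, h1, h2⟩ => by subst h1 h2; exact h, fun h => ⟨_, _, h, rfl, rfl⟩⟩

theorem hdbl_image_swap (S : Finset (ℤ × ℤ)) :
    hdbl (S.image Prod.swap) = (vdbl S).image Prod.swap := by
  ext ⟨u, v⟩
  simp only [mem_hdbl, mem_vdbl, mem_image_swap]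

theorem vdbl_image_swap (S : Finset (ℤ × ℤ)) :
    vdbl (S.image Prod.swap) = (hdbl S).image Prod.swap := by
  ext ⟨u, v⟩
  simp only [mem_hdbl, mem_vdbl, mem_image_swap]

theorem nb_image_swap (S : Finset (ℤ × ℤ)) :
    nb (S.image Prod.swap) = (nb S).image Prod.swap := by
  ext ⟨u, v⟩
  simp only [mem_nb, mem_image_swap]
  tauto

theorem card_image_swap (S : Finset (ℤ × ℤ)) : (S.image Prod.swap).card = S.card :=
  Finset.card_image_of_injective _ Prod.swap_injective

/-- Every row of `T` has no gaps, in steps of two. -/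
def RowConn (T : Finset (ℤ × ℤ)) : Prop :=
  ∀ u u' w v, (u, v) ∈ T → (u', v) ∈ T → u ≤ w → w ≤ u' → (2 : ℤ) ∣ w - u → (w, v) ∈ T

theorem exists_row_max {T : Finset (ℤ × ℤ)} {u v : ℤ} (h : (u, v) ∈ T) :
    ∃ m, (m, v) ∈ T ∧ ∀ w, (w, v) ∈ T → w ≤ m := by
  obtain ⟨⟨m, v'⟩, hm, hmax⟩ := Finset.exists_max_image (T.filter (fun p => p.2 = v)) Prod.fst
    ⟨(u, v), by simpa using h⟩
  simp only [Finset.mem_filter] at hm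
  obtain ⟨hm, rfl⟩ := hm
  exact ⟨m, hm, fun w hw => hmax (w, v') (by simpa using hw)⟩

theorem card_hdbl_eq (T : Finset (ℤ × ℤ)) :
    (hdbl T).card = T.card +
      (T.image (fun p => (p.1 + 1, p.2)) \ T.image (fun p => (p.1 - 1, p.2))).card := by
  have h : (T.image (fun p : ℤ × ℤ => (p.1 - 1, p.2))).card = T.card := by
    apply Finset.card_image_of_injective
    rintro ⟨a, b⟩ ⟨c, d⟩ h
    simpa using h
  rw [hdbl, ← Finset.sdiff_union_self_eq_union,
    Finset.card_union_of_disjoint Finset.sdiff_disjoint, h, add_comm]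

theorem mem_right_sdiff {T : Finset (ℤ × ℤ)} {u v : ℤ} :
    (u, v) ∈ T.image (fun p => (p.1 + 1, p.2)) \ T.image (fun p => (p.1 - 1, p.2)) ↔
      (u - 1, v) ∈ T ∧ (u + 1, v) ∉ T := by
  simp only [Finset.mem_sdiff, Finset.mem_image, Prod.mk.injEq, Prod.exists, not_exists, not_and]
  constructor
  · rintro ⟨⟨a, b, h, rfl, rfl⟩, h2⟩
    exact ⟨by simpa using h, fun h' => h2 _ _ h' (by ring) rfl⟩
  · rintro ⟨h1, h2⟩
    refine ⟨⟨_, _, h1, by ring, rfl⟩, ?_⟩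
    rintro a b h rfl rfl
    exact h2 (by simpa using h)

theorem image_snd_subset_right_sdiff (T : Finset (ℤ × ℤ)) : T.image Prod.snd ⊆
    (T.image (fun p => (p.1 + 1, p.2)) \ T.image (fun p => (p.1 - 1, p.2))).image Prod.snd := by
  intro v hv
  obtain ⟨⟨u, v'⟩, h, rfl⟩ := Finset.mem_image.1 hv
  obtain ⟨m, hm, hmax⟩ := exists_row_max h
  refine Finset.mem_image.2 ⟨(m + 1, v'), mem_right_sdiff.2 ⟨by simpa using hm, fun h' => ?_⟩, rfl⟩
  have := hmax _ h'
  omega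

/-- The right translate minus the left one has one point for each right end of a run of step two,
and every nonempty row has a last run. -/
theorem card_hdbl (T : Finset (ℤ × ℤ)) :
    T.card + (T.image Prod.snd).card ≤ (hdbl T).card := by
  rw [card_hdbl_eq]
  have h1 := Finset.card_le_card (image_snd_subset_right_sdiff T)
  have h2 := Finset.card_image_le (f := Prod.snd)
    (s := T.image (fun p => (p.1 + 1, p.2)) \ T.image (fun p => (p.1 - 1, p.2)))
  omega

/-- Equality leaves exactly one right end per row, whereas a gap would create a second one. -/
theorem rowConn_of_card_hdbl {T : Finset (ℤ × ℤ)}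
    (h : (hdbl T).card = T.card + (T.image Prod.snd).card) : RowConn T := by
  rw [card_hdbl_eq] at h
  have h1 := Finset.card_le_card (image_snd_subset_right_sdiff T)
  have h2 := Finset.card_image_le (f := Prod.snd)
    (s := T.image (fun p => (p.1 + 1, p.2)) \ T.image (fun p => (p.1 - 1, p.2)))
  have hinj := Finset.card_image_iff.1 (le_antisymm h2 (by omega))
  intro u u' w v hu hu' huw hwu' hd
  by_contra hw
  -- `(i, v')` is the right end of the run just before the gap at `w`; the last point of the row
  -- supplies another one.
  obtain ⟨⟨i, v'⟩, hi, hmax⟩ := Finset.exists_max_image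
    (T.filter (fun p => p.2 = v ∧ p.1 ≤ w ∧ (2 : ℤ) ∣ w - p.1)) Prod.fst
    ⟨(u, v), by simp [hu, huw, hd]⟩
  simp only [Finset.mem_filter] at hi hmax
  obtain ⟨hi, rfl, hiw, hid⟩ := hi
  have hne : i ≠ w := fun h => hw (h ▸ hi)
  have hi2 : (i + 2, v') ∉ T := fun h' => by
    have := hmax (i + 2, v') ⟨h', rfl, by simp only; omega, by simp only; omega⟩
    simp only at this
    omega
  obtain ⟨m, hm, hmm⟩ := exists_row_max hu'
  have hmu := hmm _ hu'
  have e1 : (i + 1, v') ∈ T.image (fun p => (p.1 + 1, p.2)) \ T.image (fun p => (p.1 - 1, p.2)) :=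
    mem_right_sdiff.2 ⟨by simpa using hi, by simpa [add_assoc] using hi2⟩
  have e2 : (m + 1, v') ∈ T.image (fun p => (p.1 + 1, p.2)) \ T.image (fun p => (p.1 - 1, p.2)) :=
    mem_right_sdiff.2 ⟨by simpa using hm, fun h' => by have := hmm _ h'; omega⟩
  have := hinj e1 e2 rfl
  simp only [Prod.mk.injEq, and_true] at this
  omega

theorem image_fst_image_swap (S : Finset (ℤ × ℤ)) :
    (S.image Prod.swap).image Prod.fst = S.image Prod.snd := by
  rw [Finset.image_image]; rfl

theorem image_snd_image_swap (S : Finset (ℤ × ℤ)) :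
    (S.image Prod.swap).image Prod.snd = S.image Prod.fst := by
  rw [Finset.image_image]; rfl

theorem card_vdbl (T : Finset (ℤ × ℤ)) :
    T.card + (T.image Prod.fst).card ≤ (vdbl T).card := by
  have := card_hdbl (T.image Prod.swap)
  rwa [hdbl_image_swap, card_image_swap, card_image_swap, image_snd_image_swap] at this

/-- The second coordinates of the points of `S`, as points on the horizontal axis. -/
theorem hdbl_flat (S : Finset (ℤ × ℤ)) :
    hdbl (S.image (fun p => (p.2, (0 : ℤ)))) =
      ((vdbl S).image Prod.snd).image (fun v => (v, (0 : ℤ))) := by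
  have key : ∀ (T : Finset (ℤ × ℤ)) (a b : ℤ), (a, b) ∈ T.image (fun p => (p.2, (0 : ℤ))) ↔
      b = 0 ∧ ∃ u, (u, a) ∈ T := by
    intro T a b
    simp only [Finset.mem_image, Prod.mk.injEq, Prod.exists]
    constructor
    · rintro ⟨u, v, h, rfl, rfl⟩; exact ⟨rfl, u, h⟩
    · rintro ⟨rfl, u, h⟩; exact ⟨u, a, h, rfl, rfl⟩
  rw [Finset.image_image]
  ext ⟨a, b⟩
  have := key (vdbl S) a b
  simp only [Function.comp_def]
  rw [this, mem_hdbl, key, key]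
  simp only [mem_vdbl, exists_or]
  tauto

theorem card_flat (R : Finset ℤ) : (R.image (fun v => (v, (0 : ℤ)))).card = R.card :=
  Finset.card_image_of_injective _ fun a b h => by simpa using h

theorem flat_eq (S : Finset (ℤ × ℤ)) : S.image (fun p => (p.2, (0 : ℤ))) =
    (S.image Prod.snd).image (fun v => (v, (0 : ℤ))) := by
  rw [Finset.image_image]; rfl

theorem flat_rows {S : Finset (ℤ × ℤ)} (hS : S.Nonempty) :
    ((S.image (fun p => (p.2, (0 : ℤ)))).image Prod.snd).card = 1 := by
  rw [Finset.image_image, Finset.card_eq_one]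
  refine ⟨0, ?_⟩
  rw [Finset.eq_singleton_iff_nonempty_unique_mem]
  exact ⟨hS.image _, fun x hx => by obtain ⟨p, -, rfl⟩ := Finset.mem_image.1 hx; rfl⟩

/-- The row indices, laid out on a single line, are doubled when `S` is doubled vertically, so this
is the one-row case of `card_hdbl`. -/
theorem card_rows_vdbl {S : Finset (ℤ × ℤ)} (hS : S.Nonempty) :
    (S.image Prod.snd).card + 1 ≤ ((vdbl S).image Prod.snd).card := by
  have := card_hdbl (S.image (fun p => (p.2, (0 : ℤ))))
  rwa [hdbl_flat, card_flat, flat_rows hS, flat_eq, card_flat] at this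

theorem rows_of_card_rows_vdbl {S : Finset (ℤ × ℤ)} (hS : S.Nonempty)
    (h : ((vdbl S).image Prod.snd).card = (S.image Prod.snd).card + 1)
    {p q : ℤ × ℤ} (hp : p ∈ S) (hq : q ∈ S) {v : ℤ} (h1 : p.2 ≤ v) (h2 : v ≤ q.2)
    (hd : (2 : ℤ) ∣ v - p.2) : ∃ u, (u, v) ∈ S := by
  have hc : RowConn (S.image (fun p => (p.2, (0 : ℤ)))) := by
    apply rowConn_of_card_hdbl
    rw [hdbl_flat, card_flat, flat_rows hS, flat_eq, card_flat, h]
  have := hc p.2 q.2 v 0 (Finset.mem_image_of_mem _ hp) (Finset.mem_image_of_mem _ hq) h1 h2 hd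
  obtain ⟨⟨a, b⟩, hr, h3⟩ := Finset.mem_image.1 this
  simp only [Prod.mk.injEq, and_true] at h3
  exact ⟨a, h3 ▸ hr⟩

/-- Vertical doubling adds the number of columns. Horizontal doubling then adds the number of rows
of `vdbl S`, which exceeds that of `S` by at least one. -/
theorem card_nb {S : Finset (ℤ × ℤ)} (hS : S.Nonempty) :
    S.card + (S.image Prod.fst).card + (S.image Prod.snd).card + 1 ≤ (nb S).card := by
  have h1 := card_hdbl (vdbl S)
  have h2 := card_vdbl S
  have h3 := card_rows_vdbl hS
  unfold nb
  omega

theorem rowConn_vdbl {S : Finset (ℤ × ℤ)} (hS : S.Nonempty)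
    (h : (nb S).card = S.card + (S.image Prod.fst).card + (S.image Prod.snd).card + 1) :
    RowConn (vdbl S) := by
  have h1 := card_hdbl (vdbl S)
  have h2 := card_vdbl S
  have h3 := card_rows_vdbl hS
  unfold nb at h
  exact rowConn_of_card_hdbl (by omega)

theorem exists_mem_row {S : Finset (ℤ × ℤ)} (hS : S.Nonempty)
    (h : (nb S).card = S.card + (S.image Prod.fst).card + (S.image Prod.snd).card + 1)
    {p q : ℤ × ℤ} (hp : p ∈ S) (hq : q ∈ S) {v : ℤ} (h1 : p.2 ≤ v) (h2 : v ≤ q.2)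
    (hd : (2 : ℤ) ∣ v - p.2) : ∃ u, (u, v) ∈ S := by
  have h3 := card_hdbl (vdbl S)
  have h4 := card_vdbl S
  have h5 := card_rows_vdbl hS
  unfold nb at h
  exact rows_of_card_rows_vdbl hS (by omega) hp hq h1 h2 hd

theorem card_nb_swap {S : Finset (ℤ × ℤ)}
    (h : (nb S).card = S.card + (S.image Prod.fst).card + (S.image Prod.snd).card + 1) :
    (nb (S.image Prod.swap)).card = (S.image Prod.swap).card +
      ((S.image Prod.swap).image Prod.fst).card +
      ((S.image Prod.swap).image Prod.snd).card + 1 := by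
  rw [nb_image_swap, card_image_swap, card_image_swap, image_fst_image_swap,
    image_snd_image_swap, h]
  ring

theorem exists_mem_col {S : Finset (ℤ × ℤ)} (hS : S.Nonempty)
    (h : (nb S).card = S.card + (S.image Prod.fst).card + (S.image Prod.snd).card + 1)
    {p q : ℤ × ℤ} (hp : p ∈ S) (hq : q ∈ S) {u : ℤ} (h1 : p.1 ≤ u) (h2 : u ≤ q.1)
    (hd : (2 : ℤ) ∣ u - p.1) : ∃ v, (u, v) ∈ S := by
  obtain ⟨v, hv⟩ := exists_mem_row (hS.image _) (card_nb_swap h)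
    (Finset.mem_image_of_mem Prod.swap hp) (Finset.mem_image_of_mem Prod.swap hq) h1 h2 hd
  exact ⟨v, mem_image_swap.1 hv⟩

/-- After a swap of coordinates the doublings are performed in the other order, so that equality
applies to the horizontal doubling of `S` itself and not only of `vdbl S`. -/
theorem rowConn_of_card_nb {S : Finset (ℤ × ℤ)} (hS : S.Nonempty)
    (h : (nb S).card = S.card + (S.image Prod.fst).card + (S.image Prod.snd).card + 1) :
    RowConn S := by
  have h0 := card_nb_swap h
  have h1 := card_hdbl (vdbl (S.image Prod.swap))
  have h2 := card_hdbl S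
  have h3 := card_rows_vdbl (hS.image Prod.swap)
  have h4 := card_image_swap S
  have h5 : (vdbl (S.image Prod.swap)).card = (hdbl S).card := by
    rw [vdbl_image_swap, card_image_swap]
  rw [image_fst_image_swap] at h0
  unfold nb at h0
  exact rowConn_of_card_hdbl (by omega)

theorem four_mul_card_le (S : Finset (ℤ × ℤ)) :
    4 * S.card ≤ ((S.image Prod.fst).card + (S.image Prod.snd).card) *
      ((S.image Prod.fst).card + (S.image Prod.snd).card) := by
  have h : S.card ≤ (S.image Prod.fst).card * (S.image Prod.snd).card := by
    rw [← Finset.card_product]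
    exact Finset.card_le_card fun p hp =>
      Finset.mem_product.2 ⟨Finset.mem_image_of_mem _ hp, Finset.mem_image_of_mem _ hp⟩
  zify at h ⊢
  nlinarith [sq_nonneg (((S.image Prod.fst).card : ℤ) - (S.image Prod.snd).card)]

/-! ### Boundary size and minimality in the lattice. -/

/-- All points of `S` have an even coordinate sum. -/
def Lat (S : Finset (ℤ × ℤ)) : Prop := ∀ p ∈ S, (p.1 + p.2) % 2 = 0

/-- The number of points outside `S` with a diagonal neighbour in `S`. -/
def bd (S : Finset (ℤ × ℤ)) : ℕ := (nb S \ S).card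

/-- A lattice set whose boundary is as small as possible for its cardinality. -/
def MinF (S : Finset (ℤ × ℤ)) : Prop :=
  Lat S ∧ ∀ T, Lat T → T.card = S.card → bd S ≤ bd T

theorem Lat.mem {S : Finset (ℤ × ℤ)} (h : Lat S) {u v : ℤ} (hm : (u, v) ∈ S) : (u + v) % 2 = 0 :=
  h _ hm

theorem Lat.insert {S : Finset (ℤ × ℤ)} (h : Lat S) {x : ℤ × ℤ} (hx : (x.1 + x.2) % 2 = 0) :
    Lat (insert x S) := by
  intro p hp
  rcases Finset.mem_insert.1 hp with rfl | hp
  · exact hx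
  · exact h p hp

theorem Lat.subset {S T : Finset (ℤ × ℤ)} (h : Lat T) (hST : S ⊆ T) : Lat S :=
  fun p hp => h p (hST hp)

theorem nb_mono {S T : Finset (ℤ × ℤ)} (h : S ⊆ T) : nb S ⊆ nb T := by
  rintro ⟨u, v⟩ hp
  rw [mem_nb] at hp ⊢
  exact hp.imp (Or.imp (@h _) (@h _)) (Or.imp (@h _) (@h _))

theorem nb_union (S T : Finset (ℤ × ℤ)) : nb (S ∪ T) = nb S ∪ nb T := by
  ext ⟨u, v⟩
  simp only [mem_nb, Finset.mem_union]
  tauto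

theorem nb_insert (x : ℤ × ℤ) (S : Finset (ℤ × ℤ)) : nb (insert x S) = nb {x} ∪ nb S := by
  rw [← nb_union]; rfl

theorem bd_add_card (S : Finset (ℤ × ℤ)) : bd S + S.card = (nb S ∪ S).card := by
  rw [bd, ← Finset.sdiff_union_self_eq_union,
    Finset.card_union_of_disjoint Finset.sdiff_disjoint]

/-- The boundary does not grow when a point with the largest coordinate sum is removed. -/
theorem exists_bd_erase_le {T : Finset (ℤ × ℤ)} (hT : T.Nonempty) :
    ∃ t ∈ T, bd (T.erase t) ≤ bd T := by
  obtain ⟨⟨a, b⟩, ht, hmax⟩ := Finset.exists_max_image T (fun p => p.1 + p.2) hT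
  refine ⟨(a, b), ht, ?_⟩
  have h1 := bd_add_card T
  have h2 := bd_add_card (T.erase (a, b))
  have h3 := Finset.card_erase_add_one ht
  have hm : ∀ u v, (u, v) ∈ T → u + v ≤ a + b := fun u v h => hmax _ h
  have h4 : (nb (T.erase (a, b)) ∪ T.erase (a, b)) ⊂ nb T ∪ T := by
    rw [Finset.ssubset_iff_of_subset (Finset.union_subset_union
      (nb_mono (Finset.erase_subset _ _)) (Finset.erase_subset _ _))]
    -- This point is a neighbour of `(a, b)` only: any other element of the closed neighbourhood
    -- reaching it would contradict maximality of `a + b`.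
    refine ⟨(a + 1, b + 1), Finset.mem_union_left _ (mem_nb.2 ?_), ?_⟩
    · left; left; simpa using ht
    · simp only [Finset.mem_union, mem_nb, Finset.mem_erase, ne_eq, Prod.mk.injEq, not_or, not_and]
      refine ⟨⟨⟨fun h _ => h (by ring) (by ring), fun _ h => ?_⟩, fun _ h => ?_, fun _ h => ?_⟩,
        fun _ h => ?_⟩ <;>
      · have := hm _ _ h
        omega
  have := Finset.card_lt_card h4
  omega

/-- The least boundary size is monotone in the cardinality: peel points off `T` until it has the
size of `S`. -/
theorem MinF.bd_le {S T : Finset (ℤ × ℤ)} (hS : MinF S) (hT : Lat T) (h : S.card ≤ T.card) :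
    bd S ≤ bd T := by
  obtain ⟨k, hk⟩ := Nat.exists_eq_add_of_le h
  induction k generalizing T with
  | zero => exact hS.2 T hT hk
  | succ k ih =>
    obtain ⟨t, ht, hle⟩ := exists_bd_erase_le (Finset.card_pos.1 (by omega : 0 < T.card))
    have h3 := Finset.card_erase_add_one ht
    exact (ih (hT.subset (Finset.erase_subset _ _)) (by omega) (by omega)).trans hle

theorem MinF.of_bd_le {S T : Finset (ℤ × ℤ)} (hS : MinF S) (hT : Lat T) (h : S.card ≤ T.card)
    (hb : bd T ≤ bd S) : MinF T :=
  ⟨hT, fun U hU hc => hb.trans (hS.bd_le hU (by omega))⟩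

/-- The boundary size is submodular. -/
theorem bd_insert_add_le {S C : Finset (ℤ × ℤ)} (h : S ⊆ C) {x : ℤ × ℤ} (hx : x ∉ C) :
    bd (insert x C) + bd S ≤ bd C + bd (insert x S) := by
  have e1 := bd_add_card S
  have e2 := bd_add_card C
  have e3 := bd_add_card (insert x S)
  have e4 := bd_add_card (insert x C)
  rw [Finset.card_insert_of_notMem hx] at e4
  rw [Finset.card_insert_of_notMem fun h' => hx (h h')] at e3
  -- The closed neighbourhood `nb U ∪ U` gains what that of `x` adds to it, and this gain shrinks as
  -- `U` grows.
  have key : ∀ U : Finset (ℤ × ℤ), (nb (insert x U) ∪ insert x U).card =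
      (nb U ∪ U).card + ((nb {x} ∪ {x}) \ (nb U ∪ U)).card := by
    intro U
    rw [nb_insert, add_comm, ← Finset.card_union_of_disjoint Finset.sdiff_disjoint,
      Finset.sdiff_union_self_eq_union]
    congr 1
    ext p
    simp only [Finset.mem_union, Finset.mem_insert, Finset.mem_singleton]
    tauto
  rw [key] at e3 e4
  have := Finset.card_le_card (Finset.sdiff_subset_sdiff (Finset.Subset.refl (nb {x} ∪ {x}))
    (Finset.union_subset_union (nb_mono h) h))
  omega

/-- The inserted point was itself a boundary point, which saves one; only points of `F` can be new.
-/
theorem bd_insert_le_of_card {S : Finset (ℤ × ℤ)} {x : ℤ × ℤ} (hx : x ∉ S) (hx' : x ∈ nb S)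
    {F : Finset (ℤ × ℤ)} (h : nb {x} ⊆ nb S ∪ S ∪ F) : bd (insert x S) + 1 ≤ bd S + F.card := by
  have e1 := bd_add_card S
  have e2 := bd_add_card (insert x S)
  rw [Finset.card_insert_of_notMem hx] at e2
  have h3 : nb (insert x S) ∪ insert x S ⊆ (nb S ∪ S) ∪ F := by
    rw [nb_insert]
    intro p hp
    simp only [Finset.mem_union, Finset.mem_insert] at hp ⊢
    rcases hp with (hp | hp) | rfl | hp
    · simpa [or_assoc] using h hp
    · tauto
    · tauto
    · tauto
  have := (Finset.card_le_card h3).trans (Finset.card_union_le _ _)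
  omega

/-! ### The two parity classes and the isoperimetric inequality. -/

/-- The points of `S` in columns of even index. -/
def evens (S : Finset (ℤ × ℤ)) : Finset (ℤ × ℤ) := S.filter (fun p => p.1 % 2 = 0)

/-- The points of `S` in columns of odd index. -/
def odds (S : Finset (ℤ × ℤ)) : Finset (ℤ × ℤ) := S.filter (fun p => p.1 % 2 = 1)

theorem mem_evens {S : Finset (ℤ × ℤ)} {u v : ℤ} :
    (u, v) ∈ evens S ↔ (u, v) ∈ S ∧ u % 2 = 0 := by simp [evens]

theorem mem_odds {S : Finset (ℤ × ℤ)} {u v : ℤ} :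
    (u, v) ∈ odds S ↔ (u, v) ∈ S ∧ u % 2 = 1 := by simp [odds]

theorem evens_union_odds (S : Finset (ℤ × ℤ)) : evens S ∪ odds S = S := by
  ext ⟨u, v⟩
  rw [Finset.mem_union, mem_evens, mem_odds]
  have := Int.emod_two_eq_zero_or_one u
  tauto

theorem card_evens_add_card_odds (S : Finset (ℤ × ℤ)) :
    (evens S).card + (odds S).card = S.card := by
  conv_rhs => rw [← evens_union_odds S]
  rw [Finset.card_union_of_disjoint]
  rw [Finset.disjoint_left]
  rintro ⟨u, v⟩ h1 h2
  rw [mem_evens] at h1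
  rw [mem_odds] at h2
  omega

theorem fst_of_mem_nb_evens {S : Finset (ℤ × ℤ)} {u v : ℤ} (h : (u, v) ∈ nb (evens S)) :
    u % 2 = 1 := by
  simp only [mem_nb, mem_evens] at h
  rcases h with (h | h) | h | h <;> have := h.2 <;> omega

theorem fst_of_mem_nb_odds {S : Finset (ℤ × ℤ)} {u v : ℤ} (h : (u, v) ∈ nb (odds S)) :
    u % 2 = 0 := by
  simp only [mem_nb, mem_odds] at h
  rcases h with (h | h) | h | h <;> have := h.2 <;> omega

theorem bd_eq (S : Finset (ℤ × ℤ)) :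
    bd S = (nb (evens S) \ odds S).card + (nb (odds S) \ evens S).card := by
  rw [← Finset.card_union_of_disjoint]
  · rw [bd]
    congr 1
    conv_lhs => rw [← evens_union_odds S, nb_union, evens_union_odds]
    ext ⟨u, v⟩
    simp only [Finset.mem_sdiff, Finset.mem_union]
    constructor
    · rintro ⟨h | h, h'⟩
      · exact Or.inl ⟨h, fun h2 => h' (mem_odds.1 h2).1⟩
      · exact Or.inr ⟨h, fun h2 => h' (mem_evens.1 h2).1⟩
    · rintro (⟨h, h'⟩ | ⟨h, h'⟩)
      · exact ⟨Or.inl h, fun h2 => h' (mem_odds.2 ⟨h2, fst_of_mem_nb_evens h⟩)⟩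
      · exact ⟨Or.inr h, fun h2 => h' (mem_evens.2 ⟨h2, fst_of_mem_nb_odds h⟩)⟩
  · rw [Finset.disjoint_left]
    rintro ⟨u, v⟩ h1 h2
    have := fst_of_mem_nb_evens (Finset.mem_sdiff.1 h1).1
    have := fst_of_mem_nb_odds (Finset.mem_sdiff.1 h2).1
    omega

/-- The number of nonempty columns plus the number of nonempty rows. -/
def span (S : Finset (ℤ × ℤ)) : ℕ := (S.image Prod.fst).card + (S.image Prod.snd).card

theorem four_mul_card_le_span (S : Finset (ℤ × ℤ)) : 4 * S.card ≤ span S * span S :=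
  four_mul_card_le S

theorem card_add_span_lt {S : Finset (ℤ × ℤ)} (hS : S.Nonempty) :
    S.card + span S + 1 ≤ (nb S).card := by
  have := card_nb hS
  unfold span
  omega

/-- The bound `s + 3` is one weaker than what the isoperimetric inequality needs. This slack lets
the lemma be used with `s = bd S - 3` too, which forces equality for minimal sets. -/
theorem card_le_of_evens_nonempty_of_odds_nonempty {S : Finset (ℤ × ℤ)}
    (he : (evens S).Nonempty) (ho : (odds S).Nonempty) {s : ℕ}
    (hs : span (evens S) + span (odds S) ≤ s) (hb : bd S ≤ s + 3) : S.card ≤ maxSize s := by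
  have h1 := Finset.le_card_sdiff (odds S) (nb (evens S))
  have h2 := Finset.le_card_sdiff (evens S) (nb (odds S))
  have h3 := card_add_span_lt he
  have h4 := card_add_span_lt ho
  have h5 := bd_eq S
  rw [← card_evens_add_card_odds]
  exact le_maxSize he.card_pos ho.card_pos (four_mul_card_le_span _) (four_mul_card_le_span _) hs
    (by omega) (by omega)

theorem span_add_two_le_bd {S : Finset (ℤ × ℤ)}
    (he : (evens S).Nonempty) (ho : (odds S).Nonempty) :
    span (evens S) + span (odds S) + 2 ≤ bd S := by
  have h1 := Finset.le_card_sdiff (odds S) (nb (evens S))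
  have h2 := Finset.le_card_sdiff (evens S) (nb (odds S))
  have h3 := card_add_span_lt he
  have h4 := card_add_span_lt ho
  have h5 := bd_eq S
  omega

theorem nb_empty : nb ∅ = ∅ := rfl

theorem bd_of_single_class {S : Finset (ℤ × ℤ)} (h : evens S = ∅ ∨ odds S = ∅) :
    bd S = (nb S).card := by
  have h1 := bd_eq S
  have h2 := evens_union_odds S
  rcases h with h | h
  · rw [h, Finset.empty_union] at h2
    rw [h1, h, h2, nb_empty]
    simp
  · rw [h, Finset.union_empty] at h2
    rw [h1, h, h2, nb_empty]
    simp

theorem two_le_span {S : Finset (ℤ × ℤ)} (hS : S.Nonempty) : 2 ≤ span S := by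
  have h1 := (hS.image Prod.fst).card_pos
  have h2 := (hS.image Prod.snd).card_pos
  unfold span
  omega

theorem four_le_bd {S : Finset (ℤ × ℤ)} (hS : S.Nonempty) : 4 ≤ bd S := by
  by_cases h : evens S = ∅ ∨ odds S = ∅
  · rw [bd_of_single_class h]
    have := card_add_span_lt hS
    have := two_le_span hS
    have := hS.card_pos
    omega
  · rw [not_or, ← ne_eq, ← ne_eq, ← Finset.nonempty_iff_ne_empty,
      ← Finset.nonempty_iff_ne_empty] at h
    have := span_add_two_le_bd h.1 h.2
    have := two_le_span h.1
    omega

/-- The vertex-isoperimetric inequality. -/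
theorem card_le_maxSize {S : Finset (ℤ × ℤ)} (hS : S.Nonempty) : S.card ≤ maxSize (bd S - 2) := by
  have h4 := four_le_bd hS
  by_cases h : evens S = ∅ ∨ odds S = ∅
  · have := card_add_span_lt hS
    rw [bd_of_single_class h] at h4 ⊢
    exact le_maxSize_single hS.card_pos (four_mul_card_le_span S) (by omega)
  · rw [not_or, ← ne_eq, ← ne_eq, ← Finset.nonempty_iff_ne_empty,
      ← Finset.nonempty_iff_ne_empty] at h
    have := span_add_two_le_bd h.1 h.2
    exact card_le_of_evens_nonempty_of_odds_nonempty h.1 h.2 (by omega) (by omega)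

/-! ### Rectangles as extremal sets. -/

/-- The lattice points of a rectangle. -/
noncomputable def rect (a b c d : ℤ) : Finset (ℤ × ℤ) :=
  (Finset.Icc a b ×ˢ Finset.Icc c d).filter (fun p => (p.1 + p.2) % 2 = 0)

theorem mem_rect {a b c d u v : ℤ} : (u, v) ∈ rect a b c d ↔
    ((a ≤ u ∧ u ≤ b) ∧ c ≤ v ∧ v ≤ d) ∧ (u + v) % 2 = 0 := by simp [rect]

theorem lat_rect (a b c d : ℤ) : Lat (rect a b c d) := by
  rintro ⟨u, v⟩ h
  exact (mem_rect.1 h).2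

theorem card_rect_col (a c : ℤ) (n : ℕ) (h : (a + c) % 2 = 0) :
    (rect a a c (c + n - 1)).card = (n + 1) / 2 ∧ (rect a a (c - 1) (c + n - 2)).card = n / 2 := by
  induction n with
  | zero =>
    constructor
    · rw [Finset.card_eq_zero.2]
      ext ⟨u, v⟩; simp only [mem_rect, Finset.notMem_empty, iff_false]; omega
    · rw [Finset.card_eq_zero.2]
      ext ⟨u, v⟩; simp only [mem_rect, Finset.notMem_empty, iff_false]; omega
  | succ n ih =>
    have key : ∀ l m : ℤ, l ≤ m + 1 → (rect a a l (m + 1)).card = (rect a a l m).card +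
        if (a + (m + 1)) % 2 = 0 then 1 else 0 := by
      intro l m hl
      split_ifs with hp
      · rw [← Finset.card_insert_of_notMem (a := (a, m + 1)) (by simp only [mem_rect]; omega)]
        congr 1
        ext ⟨u, v⟩
        simp only [mem_rect, Finset.mem_insert, Prod.mk.injEq]
        omega
      · rw [add_zero]
        congr 1
        ext ⟨u, v⟩
        simp only [mem_rect]
        omega
    have e1 : c + ((n + 1 : ℕ) : ℤ) - 1 = (c + n - 1) + 1 := by push_cast; ring
    have e2 : c + ((n + 1 : ℕ) : ℤ) - 2 = (c + n - 2) + 1 := by push_cast; ring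
    rw [e1, e2, key _ _ (by omega), key _ _ (by omega), ih.1, ih.2]
    constructor
    · split_ifs <;> omega
    · split_ifs <;> omega

theorem card_rect_add_col {a b c d : ℤ} (h : a ≤ b + 1) :
    (rect a (b + 1) c d).card = (rect a b c d).card + (rect (b + 1) (b + 1) c d).card := by
  rw [← Finset.card_union_of_disjoint]
  · congr 1
    ext ⟨u, v⟩
    simp only [mem_rect, Finset.mem_union]
    omega
  · rw [Finset.disjoint_left]
    rintro ⟨u, v⟩ h1 h2
    simp only [mem_rect] at h1 h2
    omega

theorem card_rect (a c : ℤ) (h : (a + c) % 2 = 0) (m n : ℕ) :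
    (rect a (a + m - 1) c (c + n - 1)).card = (m * n + 1) / 2 := by
  induction m with
  | zero =>
    rw [Finset.card_eq_zero.2]
    · simp
    ext ⟨u, v⟩; simp only [mem_rect, Finset.notMem_empty, iff_false]; omega
  | succ m ih =>
    have e1 : a + ((m + 1 : ℕ) : ℤ) - 1 = (a + m - 1) + 1 := by push_cast; ring
    rw [e1, card_rect_add_col (by omega), ih]
    rcases Nat.even_or_odd' m with ⟨k, rfl | rfl⟩
    · rw [(card_rect_col _ c n (by push_cast; omega)).1, add_mul, mul_assoc]
      omega
    · have e2 := (card_rect_col (a + ((2 * k + 1 : ℕ) : ℤ) - 1 + 1) (c + 1) n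
        (by push_cast; omega)).2
      have e3 : c + 1 - 1 = c := by ring
      have e4 : c + 1 + (n : ℤ) - 2 = c + n - 1 := by ring
      rw [e3, e4] at e2
      rw [e2]
      have e5 : (2 * k + 1) * n = 2 * (k * n) + n := by ring
      have e6 : (2 * k + 1 + 1) * n = 2 * (k * n) + 2 * n := by ring
      omega

/-- Boxes of almost equal side lengths attain the isoperimetric inequality. -/
theorem exists_card_eq_maxSize (s : ℕ) :
    ∃ S, Lat S ∧ S.card = maxSize s ∧ bd S ≤ s + 2 := by
  obtain ⟨m, n, hs, hmn⟩ : ∃ m n : ℕ, m + n = s ∧ maxSize s = (m * n + 1) / 2 := by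
    rcases Nat.even_or_odd' s with ⟨t, rfl | rfl⟩
    · exact ⟨t, t, by ring, maxSize_even t⟩
    · refine ⟨t, t + 1, by ring, ?_⟩
      rw [maxSize_odd]
      have := Nat.even_iff.1 (Nat.even_mul_succ_self t)
      omega
  have h1 := card_rect 0 0 (by norm_num) m n
  have h2 := card_rect (-1) (-1) (by norm_num) (m + 2) (n + 2)
  refine ⟨_, lat_rect 0 (0 + m - 1) 0 (0 + n - 1), by rw [h1, hmn], ?_⟩
  have h3 := bd_add_card (rect 0 (0 + m - 1) 0 (0 + n - 1))
  -- The closed neighbourhood fits in the rectangle enlarged by one on each side, which has `m + n +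
  -- 2` more lattice points.
  have h4 : nb (rect 0 (0 + m - 1) 0 (0 + n - 1)) ∪ rect 0 (0 + m - 1) 0 (0 + n - 1) ⊆
      rect (-1) (-1 + (m + 2 : ℕ) - 1) (-1) (-1 + (n + 2 : ℕ) - 1) := by
    rintro ⟨u, v⟩ h
    simp only [Finset.mem_union, mem_nb, mem_rect] at h ⊢
    push_cast
    omega
  have h5 := Finset.card_le_card h4
  have h6 : (m + 2) * (n + 2) = m * n + 2 * m + 2 * n + 4 := by ring
  omega

/-- A minimal set does not fit under a smaller boundary. -/
theorem MinF.maxSize_lt {S : Finset (ℤ × ℤ)} (hS : MinF S) {s : ℕ} (h : s + 2 < bd S) :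
    maxSize s < S.card := by
  obtain ⟨T, hT, hc, hb⟩ := exists_card_eq_maxSize s
  by_contra hlt
  have := hS.bd_le hT (by omega)
  omega

/-- A competitor with smaller boundary would have boundary at most `s + 2`, hence at most `maxSize
s` points. -/
theorem minF_of_maxSize_lt {S : Finset (ℤ × ℤ)} (hL : Lat S) {s : ℕ} (h : bd S ≤ s + 3)
    (hc : maxSize s < S.card) : MinF S := by
  refine ⟨hL, fun T hT hTc => ?_⟩
  by_contra hlt
  have hne : T.Nonempty := Finset.card_pos.1 (by omega)
  have h1 := card_le_maxSize hne
  have h2 := maxSize_mono (by omega : bd T - 2 ≤ s)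
  omega

/-! ### Tight sets and filling the bounding rectangle. -/

/-- The point `(u, v)` has a diagonal neighbour satisfying `P`. -/
def HasNb (P : ℤ → ℤ → Prop) (u v : ℤ) : Prop :=
  (P (u - 1) (v - 1) ∨ P (u - 1) (v + 1)) ∨ P (u + 1) (v - 1) ∨ P (u + 1) (v + 1)

theorem HasNb.intro {P : ℤ → ℤ → Prop} {u v u' v' : ℤ} (h : P u' v')
    (hu : u' = u - 1 ∨ u' = u + 1) (hv : v' = v - 1 ∨ v' = v + 1) : HasNb P u v := by
  unfold HasNb
  rcases hu with rfl | rfl <;> rcases hv with rfl | rfl <;> tauto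

/-- The point `(u, v)` and at least three of its four neighbours have a neighbour in `P`. -/
def Good (P : ℤ → ℤ → Prop) (u v : ℤ) : Prop :=
  HasNb P u v ∧
    ((HasNb P (u - 1) (v - 1) ∧ HasNb P (u - 1) (v + 1) ∧
      (HasNb P (u + 1) (v - 1) ∨ HasNb P (u + 1) (v + 1))) ∨
    (HasNb P (u + 1) (v - 1) ∧ HasNb P (u + 1) (v + 1) ∧
      (HasNb P (u - 1) (v - 1) ∨ HasNb P (u - 1) (v + 1))))

/-- The local convexity properties shared by all minimal sets that meet both classes of
diagonals. -/
structure Tight (P : ℤ → ℤ → Prop) : Prop where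
  par : ∀ u v, P u v → (u + v) % 2 = 0
  row : ∀ u u' w v, P u v → P u' v → u ≤ w → w ≤ u' → (2 : ℤ) ∣ w - u → P w v
  vert : ∀ u u' w v, (P u (v - 1) ∨ P u (v + 1)) → (P u' (v - 1) ∨ P u' (v + 1)) →
    u ≤ w → w ≤ u' → (2 : ℤ) ∣ w - u → (P w (v - 1) ∨ P w (v + 1))
  adj : ∀ u v, P u v → HasNb P u v

/-- Going down from a row that reaches the right side `b`, the first row stopping before `b - 1`
would make the point two steps beyond its right end good, contrary to `hgood`. By parity, `b - 1` or
`b` is the last lattice position of a row. -/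
theorem Tight.exists_right {P : ℤ → ℤ → Prop} (hP : Tight P) {b c v₀ : ℤ} (hb : P b v₀)
    (hle : ∀ u v, P u v → u ≤ b) (hrow : ∀ v, c ≤ v → v ≤ v₀ → ∃ u, P u v)
    (hgood : ∀ u v, ¬ P u v → (u + v) % 2 = 0 → u ≤ b → (∃ u' ≤ u, P u' v) → ¬ Good P u v)
    (k : ℕ) (hk : c ≤ v₀ - k) : ∃ u, b - 1 ≤ u ∧ P u (v₀ - k) := by
  induction k using Nat.strong_induction_on with
  | _ k ih =>
  rcases k with _ | k
  · exact ⟨b, by omega, by simpa using hb⟩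
  obtain ⟨v, hv⟩ : ∃ v, v = v₀ - ((k + 1 : ℕ) : ℤ) := ⟨_, rfl⟩
  rw [← hv] at hk ⊢
  push_cast at hv
  obtain ⟨R, hR, hmax⟩ := Int.exists_greatest_of_bdd (P := fun u => P u v)
    ⟨b, fun u hu => hle u v hu⟩ (hrow v hk (by omega))
  by_contra hcon
  push Not at hcon
  have hRb : R + 2 ≤ b := by
    by_contra h
    exact hcon R (by omega) hR
  have hx : ¬ P (R + 2) v := fun h => by have := hmax _ h; omega
  have hRv := hP.par _ _ hR
  obtain ⟨r, hr, hrP⟩ := ih k (by omega) (by omega)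
  rw [show v₀ - (k : ℤ) = v + 1 by omega] at hrP
  have hrv := hP.par _ _ hrP
  refine hgood (R + 2) v hx (by omega) hRb ⟨R, by omega, hR⟩ ?_
  suffices H : HasNb P (R + 2) v ∧ (HasNb P (R + 3) (v - 1) ∨ HasNb P (R + 3) (v + 1)) by
    refine ⟨H.1, Or.inl ⟨HasNb.intro hR (by omega) (by omega),
      HasNb.intro hR (by omega) (by omega), ?_⟩⟩
    rw [show R + 2 + 1 = R + 3 by ring]
    exact H.2
  have hup : P (R + 3) (v + 1) → HasNb P (R + 2) v ∧
      (HasNb P (R + 3) (v - 1) ∨ HasNb P (R + 3) (v + 1)) := fun h =>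
    ⟨HasNb.intro h (by omega) (by omega), Or.inr (hP.adj _ _ h)⟩
  by_cases hc : ∃ w ≤ R + 1, P w (v + 1)
  · obtain ⟨w, hw, hwP⟩ := hc
    have hwv := hP.par _ _ hwP
    by_cases hr3 : R + 3 ≤ r
    · exact hup (hP.row w r _ _ hwP hrP (by omega) hr3 (by omega))
    -- Here `b = R + 2`, and row `v + 1` ends at its last lattice position. Parity excludes that it
    -- is the starting row, so row `v + 2` is also known and must reach `b`.
    · obtain rfl : r = R + 1 := by omega
      rcases k with _ | k
      · have := hP.par _ _ hb
        push_cast at hv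
        omega
      · obtain ⟨r', hr', hrP'⟩ := ih k (by omega) (by push_cast at hv; omega)
        rw [show v₀ - (k : ℤ) = v + 2 by push_cast at hv; omega] at hrP'
        have h1 := hP.par _ _ hrP'
        have h2 := hle _ _ hrP'
        obtain rfl : r' = R + 2 := by omega
        exact ⟨HasNb.intro hrP (by omega) (by omega),
          Or.inr (HasNb.intro hrP' (by omega) (by omega))⟩
  · push Not at hc
    by_cases h3 : P (R + 3) (v + 1)
    · exact hup h3
    have hr1 : R + 1 < r := by
      by_contra h
      exact hc r (by omega) hrP
    have hr3 : r ≠ R + 3 := fun h => h3 (h ▸ hrP)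
    -- Row `v + 1` lies entirely beyond `R + 1`, so the neighbour of `(R, v)` is below it. Convexity
    -- of the vertical doubling then forces `(R + 3, v - 1)`.
    obtain ⟨w, hw, hwP⟩ : ∃ w, (w = R - 1 ∨ w = R + 1) ∧ P w (v - 1) := by
      rcases hP.adj _ _ hR with (h | h) | h | h
      · exact ⟨_, Or.inl rfl, h⟩
      · exact absurd h (hc _ (by omega))
      · exact ⟨_, Or.inr rfl, h⟩
      · exact absurd h (hc _ (by omega))
    rcases hP.vert w r (R + 3) v (Or.inl hwP) (Or.inr hrP) (by omega) (by omega)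
      (by omega) with h | h
    · exact ⟨HasNb.intro h (by omega) (by omega), Or.inl (hP.adj _ _ h)⟩
    · exact absurd h h3

theorem hasNb_neg_left {P : ℤ → ℤ → Prop} {u v : ℤ} :
    HasNb (fun u v => P (-u) v) u v ↔ HasNb P (-u) v := by
  unfold HasNb
  beta_reduce
  rw [show -(u - 1) = -u + 1 by ring, show -(u + 1) = -u - 1 by ring]
  tauto

theorem hasNb_neg_right {P : ℤ → ℤ → Prop} {u v : ℤ} :
    HasNb (fun u v => P u (-v)) u v ↔ HasNb P u (-v) := by
  unfold HasNb
  beta_reduce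
  rw [show -(v - 1) = -v + 1 by ring, show -(v + 1) = -v - 1 by ring]
  tauto

theorem good_neg_left {P : ℤ → ℤ → Prop} {u v : ℤ} :
    Good (fun u v => P (-u) v) u v ↔ Good P (-u) v := by
  unfold Good
  simp only [hasNb_neg_left]
  rw [show -(u - 1) = -u + 1 by ring, show -(u + 1) = -u - 1 by ring]
  tauto

theorem good_neg_right {P : ℤ → ℤ → Prop} {u v : ℤ} :
    Good (fun u v => P u (-v)) u v ↔ Good P u (-v) := by
  unfold Good
  simp only [hasNb_neg_right]
  rw [show -(v - 1) = -v + 1 by ring, show -(v + 1) = -v - 1 by ring]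
  tauto

theorem Tight.neg_left {P : ℤ → ℤ → Prop} (hP : Tight P) : Tight (fun u v => P (-u) v) where
  par u v h := by have := hP.par _ _ h; omega
  row u u' w v h h' h1 h2 h3 := by
    have e1 := hP.par _ _ h
    have e2 := hP.par _ _ h'
    exact hP.row _ _ _ _ h' h (by omega) (by omega) (by omega)
  vert u u' w v h h' h1 h2 h3 := by
    have e1 : (-u + v) % 2 = 1 := by
      rcases h with h | h <;> have := hP.par _ _ h <;> omega
    have e2 : (-u' + v) % 2 = 1 := by
      rcases h' with h | h <;> have := hP.par _ _ h <;> omega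
    exact hP.vert _ _ _ _ h' h (by omega) (by omega) (by omega)
  adj u v h := hasNb_neg_left.2 (hP.adj _ _ h)

theorem Tight.neg_right {P : ℤ → ℤ → Prop} (hP : Tight P) : Tight (fun u v => P u (-v)) where
  par u v h := by have := hP.par _ _ h; omega
  row u u' w v h h' h1 h2 h3 := hP.row _ _ _ _ h h' h1 h2 h3
  vert u u' w v h h' h1 h2 h3 := by
    rw [show -(v - 1) = -v + 1 by ring, show -(v + 1) = -v - 1 by ring] at h h' ⊢
    exact (hP.vert _ _ _ _ h.symm h'.symm h1 h2 h3).symm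
  adj u v h := hasNb_neg_right.2 (hP.adj _ _ h)

theorem Tight.exists_right_of_mem {P : ℤ → ℤ → Prop} (hP : Tight P) {b c d v₀ : ℤ} (hb : P b v₀)
    (hle : ∀ u v, P u v → u ≤ b) (hrow : ∀ v, c ≤ v → v ≤ d → ∃ u, P u v)
    (hgood : ∀ u v, ¬ P u v → (u + v) % 2 = 0 → u ≤ b → (∃ u' ≤ u, P u' v) → ¬ Good P u v)
    (h0 : c ≤ v₀ ∧ v₀ ≤ d) {v : ℤ} (h1 : c ≤ v) (h2 : v ≤ d) : ∃ u, b - 1 ≤ u ∧ P u v := by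
  rcases le_total v v₀ with h | h
  · obtain ⟨k, hk⟩ := Int.eq_ofNat_of_zero_le (sub_nonneg.2 h)
    have := hP.exists_right hb hle (fun v h1 h2 => hrow v h1 (by omega)) hgood k (by omega)
    rwa [show v₀ - (k : ℤ) = v by omega] at this
  · obtain ⟨k, hk⟩ := Int.eq_ofNat_of_zero_le (sub_nonneg.2 h)
    have := hP.neg_right.exists_right (b := b) (c := -d) (v₀ := -v₀) (by simpa using hb)
      (fun u v h => hle _ _ h) (fun v h1 h2 => hrow (-v) (by omega) (by omega))
      (fun u v g1 g2 g3 g4 g5 => hgood u (-v) g1 (by omega) g3 g4 (good_neg_right.1 g5)) k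
      (by omega)
    rwa [show -(-v₀ - (k : ℤ)) = v by omega] at this

/-- `S` lies in the rectangle `[a, b] × [c, d]` and meets its four sides. -/
structure Bounds (S : Finset (ℤ × ℤ)) (a b c d : ℤ) : Prop where
  mem : ∀ u v, (u, v) ∈ S → (a ≤ u ∧ u ≤ b) ∧ c ≤ v ∧ v ≤ d
  left : ∃ v, (a, v) ∈ S
  right : ∃ v, (b, v) ∈ S
  bot : ∃ u, (u, c) ∈ S
  top : ∃ u, (u, d) ∈ S

theorem exists_bounds {S : Finset (ℤ × ℤ)} (hS : S.Nonempty) : ∃ a b c d, Bounds S a b c d := by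
  obtain ⟨⟨a, a'⟩, ha, ha'⟩ := Finset.exists_min_image S Prod.fst hS
  obtain ⟨⟨b, b'⟩, hb, hb'⟩ := Finset.exists_max_image S Prod.fst hS
  obtain ⟨⟨c', c⟩, hc, hc'⟩ := Finset.exists_min_image S Prod.snd hS
  obtain ⟨⟨d', d⟩, hd, hd'⟩ := Finset.exists_max_image S Prod.snd hS
  exact ⟨a, b, c, d, fun u v h => ⟨⟨ha' _ h, hb' _ h⟩, hc' _ h, hd' _ h⟩, ⟨_, ha⟩, ⟨_, hb⟩,
    ⟨_, hc⟩, ⟨_, hd⟩⟩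

theorem Bounds.subset_rect {S : Finset (ℤ × ℤ)} {a b c d : ℤ} (h : Bounds S a b c d)
    (hL : Lat S) : S ⊆ rect a b c d := by
  rintro ⟨u, v⟩ hp
  exact mem_rect.2 ⟨h.mem _ _ hp, hL _ hp⟩

theorem Bounds.insert {S : Finset (ℤ × ℤ)} {a b c d : ℤ} (h : Bounds S a b c d)
    {x : ℤ × ℤ} (hx : x ∈ rect a b c d) : Bounds (insert x S) a b c d where
  mem u v hp := by
    rcases Finset.mem_insert.1 hp with rfl | hp
    · exact (mem_rect.1 hx).1
    · exact h.mem _ _ hp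
  left := h.left.imp fun _ => Finset.mem_insert_of_mem
  right := h.right.imp fun _ => Finset.mem_insert_of_mem
  bot := h.bot.imp fun _ => Finset.mem_insert_of_mem
  top := h.top.imp fun _ => Finset.mem_insert_of_mem

/-- Only the fourth neighbour can be a new boundary point, while `(u, v)` ceases to be one. -/
theorem bd_insert_le_of_good {S : Finset (ℤ × ℤ)} {u v : ℤ} (hx : (u, v) ∉ S)
    (hg : Good (fun u v => (u, v) ∈ S) u v) : bd (insert (u, v) S) ≤ bd S := by
  have hnb : ∀ u v, HasNb (fun u v => (u, v) ∈ S) u v ↔ (u, v) ∈ nb S := fun u v => mem_nb.symm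
  simp only [Good, hnb] at hg
  suffices H : ∃ q, nb {(u, v)} ⊆ nb S ∪ S ∪ {q} by
    obtain ⟨q, hq⟩ := H
    have := bd_insert_le_of_card hx hg.1 hq
    rw [Finset.card_singleton] at this
    omega
  suffices H : ∃ q, ∀ u' v', (u' = u - 1 ∨ u' = u + 1) → (v' = v - 1 ∨ v' = v + 1) →
      (u', v') ∈ nb S ∨ (u', v') = q by
    obtain ⟨q, hq⟩ := H
    refine ⟨q, ?_⟩
    rintro ⟨u', v'⟩ hp
    simp only [mem_nb, Finset.mem_singleton, Prod.mk.injEq] at hp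
    simp only [Finset.mem_union, Finset.mem_singleton]
    have := hq u' v' (by omega) (by omega)
    tauto
  obtain ⟨-, ⟨h1, h2, h3 | h3⟩ | ⟨h1, h2, h3 | h3⟩⟩ := hg
  · exact ⟨(u + 1, v + 1), by rintro u' v' (rfl | rfl) (rfl | rfl) <;> tauto⟩
  · exact ⟨(u + 1, v - 1), by rintro u' v' (rfl | rfl) (rfl | rfl) <;> tauto⟩
  · exact ⟨(u - 1, v + 1), by rintro u' v' (rfl | rfl) (rfl | rfl) <;> tauto⟩
  · exact ⟨(u - 1, v - 1), by rintro u' v' (rfl | rfl) (rfl | rfl) <;> tauto⟩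

/-- A tight set without empty rows that differs from its bounding box can be enlarged inside the
box without increasing the boundary. -/
theorem Tight.exists_insert {S : Finset (ℤ × ℤ)} (hT : Tight (fun u v => (u, v) ∈ S))
    {a b c d : ℤ} (hB : Bounds S a b c d) (hrow : ∀ v, c ≤ v → v ≤ d → ∃ u, (u, v) ∈ S)
    (hne : S ≠ rect a b c d) : ∃ x ∈ rect a b c d, x ∉ S ∧ bd (insert x S) ≤ bd S := by
  by_contra hcon
  push Not at hcon
  have hgood : ∀ u v, (u, v) ∈ rect a b c d → (u, v) ∉ S → ¬ Good (fun u v => (u, v) ∈ S) u v :=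
    fun u v h1 h2 h3 => (hcon _ h1 h2).not_ge (bd_insert_le_of_good h2 h3)
  obtain ⟨vb, hvb⟩ := hB.right
  obtain ⟨va, hva⟩ := hB.left
  apply hne
  apply Finset.Subset.antisymm
  · rintro ⟨u, v⟩ hp
    exact mem_rect.2 ⟨hB.mem _ _ hp, hT.par _ _ hp⟩
  · rintro ⟨u, v⟩ hp
    have hp' := mem_rect.1 hp
    obtain ⟨r, hr, hrS⟩ := hT.exists_right_of_mem hvb (fun u v h => (hB.mem _ _ h).1.2) hrow
      (fun u v g1 g2 g3 ⟨u', g4, g5⟩ => hgood u v (mem_rect.2 ⟨⟨⟨(hB.mem _ _ g5).1.1.trans g4, g3⟩,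
        (hB.mem _ _ g5).2⟩, g2⟩) g1) (hB.mem _ _ hvb).2 hp'.1.2.1 hp'.1.2.2
    obtain ⟨l, hl, hlS⟩ := hT.neg_left.exists_right_of_mem (b := -a) (v₀ := va) (by simpa using hva)
      (fun u v h => by have := (hB.mem _ _ h).1.1; omega)
      (fun v h1 h2 => by obtain ⟨u, hu⟩ := hrow v h1 h2; exact ⟨-u, by simpa using hu⟩)
      (fun u v g1 g2 g3 ⟨u', g4, g5⟩ g6 => hgood (-u) v (mem_rect.2 ⟨⟨⟨by omega, by
        have := (hB.mem _ _ g5).1.2; omega⟩, (hB.mem _ _ g5).2⟩, by omega⟩) g1 (good_neg_left.1 g6))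
      (hB.mem _ _ hva).2 hp'.1.2.1 hp'.1.2.2
    have e1 := hT.par _ _ hrS
    have e2 := hT.par _ _ hlS
    -- By parity `-l` and `r` are the extreme lattice positions of the row, and row convexity fills
    -- everything between.
    exact hT.row _ _ u v hlS hrS (by omega) (by omega) (by omega)

/-! ### The equality case for minimal sets. -/

theorem MinF.bd_lt_span {S : Finset (ℤ × ℤ)} (hS : MinF S)
    (he : (evens S).Nonempty) (ho : (odds S).Nonempty) :
    bd S < span (evens S) + span (odds S) + 3 := by
  by_contra h
  push Not at h
  have h1 := card_le_of_evens_nonempty_of_odds_nonempty he ho (s := bd S - 3) (by omega) (by omega)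
  have h2 := hS.maxSize_lt (s := bd S - 3) (by omega)
  omega

theorem subset_of_card_sdiff {U V : Finset (ℤ × ℤ)} (h : (V \ U).card + U.card ≤ V.card) :
    U ⊆ V := by
  rw [Finset.card_sdiff] at h
  have h1 : (U ∩ V).card ≤ V.card := Finset.card_le_card Finset.inter_subset_right
  have h2 : U ∩ V = U := Finset.eq_of_subset_of_card_le Finset.inter_subset_left (by omega)
  exact h2 ▸ Finset.inter_subset_right

/-- With `bd S` at its lower bound there is no loss in either neighbour count or in either set
difference. The latter means that each class lies in the neighbour set of the other. -/
theorem MinF.card_nb_evens {S : Finset (ℤ × ℤ)} (hS : MinF S)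
    (he : (evens S).Nonempty) (ho : (odds S).Nonempty) :
    bd S = span (evens S) + span (odds S) + 2 ∧
    (nb (evens S)).card = (evens S).card + span (evens S) + 1 ∧
    (nb (odds S)).card = (odds S).card + span (odds S) + 1 ∧
    odds S ⊆ nb (evens S) ∧ evens S ⊆ nb (odds S) := by
  have h0 := hS.bd_lt_span he ho
  have h1 := Finset.le_card_sdiff (odds S) (nb (evens S))
  have h2 := Finset.le_card_sdiff (evens S) (nb (odds S))
  have h3 := card_add_span_lt he
  have h4 := card_add_span_lt ho
  have h5 := bd_eq S
  refine ⟨by omega, by omega, by omega, subset_of_card_sdiff (by omega),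
    subset_of_card_sdiff (by omega)⟩

theorem MinF.tight {S : Finset (ℤ × ℤ)} (hS : MinF S)
    (he : (evens S).Nonempty) (ho : (odds S).Nonempty) : Tight (fun u v => (u, v) ∈ S) := by
  obtain ⟨-, h1, h2, h3, h4⟩ := hS.card_nb_evens he ho
  have h1' : (nb (evens S)).card = (evens S).card + ((evens S).image Prod.fst).card +
      ((evens S).image Prod.snd).card + 1 := by rw [h1, span]; ring
  have h2' : (nb (odds S)).card = (odds S).card + ((odds S).image Prod.fst).card +
      ((odds S).image Prod.snd).card + 1 := by rw [h2, span]; ring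
  refine ⟨fun u v h => hS.1 _ h, ?_, ?_, ?_⟩
  · intro u u' w v hu hu' huw hwu' hd
    have e1 := hS.1.mem hu
    have e2 := hS.1.mem hu'
    rcases Int.emod_two_eq_zero_or_one u with h | h
    · exact (mem_evens.1 (rowConn_of_card_nb he h1' u u' w v (mem_evens.2 ⟨hu, h⟩)
        (mem_evens.2 ⟨hu', by omega⟩) huw hwu' hd)).1
    · exact (mem_odds.1 (rowConn_of_card_nb ho h2' u u' w v (mem_odds.2 ⟨hu, h⟩)
        (mem_odds.2 ⟨hu', by omega⟩) huw hwu' hd)).1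
  · intro u u' w v hu hu' huw hwu' hd
    have e1 : (u + v) % 2 = 1 := by
      rcases hu with h | h <;> have := hS.1.mem h <;> omega
    have e2 : (u' + v) % 2 = 1 := by
      rcases hu' with h | h <;> have := hS.1.mem h <;> omega
    rcases Int.emod_two_eq_zero_or_one u with h | h
    · have := rowConn_vdbl he h1' u u' w v
        (mem_vdbl.2 (hu.imp (fun g => mem_evens.2 ⟨g, h⟩) (fun g => mem_evens.2 ⟨g, h⟩)))
        (mem_vdbl.2 (hu'.imp (fun g => mem_evens.2 ⟨g, by omega⟩)
          (fun g => mem_evens.2 ⟨g, by omega⟩))) huw hwu' hd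
      exact (mem_vdbl.1 this).imp (fun g => (mem_evens.1 g).1) (fun g => (mem_evens.1 g).1)
    · have := rowConn_vdbl ho h2' u u' w v
        (mem_vdbl.2 (hu.imp (fun g => mem_odds.2 ⟨g, h⟩) (fun g => mem_odds.2 ⟨g, h⟩)))
        (mem_vdbl.2 (hu'.imp (fun g => mem_odds.2 ⟨g, by omega⟩)
          (fun g => mem_odds.2 ⟨g, by omega⟩))) huw hwu' hd
      exact (mem_vdbl.1 this).imp (fun g => (mem_odds.1 g).1) (fun g => (mem_odds.1 g).1)
  · intro u v h
    rcases Int.emod_two_eq_zero_or_one u with h' | h'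
    · exact mem_nb.1 (nb_mono (Finset.filter_subset _ _) (h4 (mem_evens.2 ⟨h, h'⟩)))
    · exact mem_nb.1 (nb_mono (Finset.filter_subset _ _) (h3 (mem_odds.2 ⟨h, h'⟩)))

/-- The rows of each class have no gaps in steps of two. If the extreme row has the wrong parity, a
neighbour of its point supplies the other class. -/
theorem MinF.exists_mem_row {S : Finset (ℤ × ℤ)} (hS : MinF S)
    (he : (evens S).Nonempty) (ho : (odds S).Nonempty) {a b c d : ℤ} (hB : Bounds S a b c d)
    {v : ℤ} (h1 : c ≤ v) (h2 : v ≤ d) : ∃ u, (u, v) ∈ S := by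
  have hT := hS.tight he ho
  obtain ⟨-, hE, hO, -, -⟩ := hS.card_nb_evens he ho
  have hlow : ∃ p ∈ S, p.2 ≤ v ∧ (v - p.2) % 2 = 0 := by
    obtain ⟨u, hu⟩ := hB.bot
    by_cases hc : (v - c) % 2 = 0
    · exact ⟨_, hu, h1, hc⟩
    · rcases hT.adj _ _ hu with (h | h) | h | h <;>
        exact ⟨_, h, by simp only; omega, by simp only; omega⟩
  have hupp : ∃ p ∈ S, v ≤ p.2 ∧ (v - p.2) % 2 = 0 := by
    obtain ⟨u, hu⟩ := hB.top
    by_cases hc : (v - d) % 2 = 0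
    · exact ⟨_, hu, h2, hc⟩
    · rcases hT.adj _ _ hu with (h | h) | h | h <;>
        exact ⟨_, h, by simp only; omega, by simp only; omega⟩
  obtain ⟨⟨p, p'⟩, hp, g1, g2⟩ := hlow
  obtain ⟨⟨q, q'⟩, hq, g3, g4⟩ := hupp
  have e1 := hS.1.mem hp
  have e2 := hS.1.mem hq
  simp only at g1 g2 g3 g4
  rcases Int.emod_two_eq_zero_or_one p with h | h
  · obtain ⟨u, hu⟩ := PlanarIso.exists_mem_row he (by rw [hE, span]; ring)
      (mem_evens.2 ⟨hp, h⟩) (mem_evens.2 ⟨hq, by omega⟩) g1 g3 (by simp only; omega)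
    exact ⟨u, (mem_evens.1 hu).1⟩
  · obtain ⟨u, hu⟩ := PlanarIso.exists_mem_row ho (by rw [hO, span]; ring)
      (mem_odds.2 ⟨hp, h⟩) (mem_odds.2 ⟨hq, by omega⟩) g1 g3 (by simp only; omega)
    exact ⟨u, (mem_odds.1 hu).1⟩

theorem MinF.exists_mem_col {S : Finset (ℤ × ℤ)} (hS : MinF S)
    (he : (evens S).Nonempty) (ho : (odds S).Nonempty) {a b c d : ℤ} (hB : Bounds S a b c d)
    {u : ℤ} (h1 : a ≤ u) (h2 : u ≤ b) : ∃ v, (u, v) ∈ S := by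
  have hT := hS.tight he ho
  obtain ⟨-, hE, hO, -, -⟩ := hS.card_nb_evens he ho
  have hlow : ∃ p ∈ S, p.1 ≤ u ∧ (u - p.1) % 2 = 0 := by
    obtain ⟨v, hv⟩ := hB.left
    by_cases hc : (u - a) % 2 = 0
    · exact ⟨_, hv, h1, hc⟩
    · rcases hT.adj _ _ hv with (h | h) | h | h <;>
        exact ⟨_, h, by simp only; omega, by simp only; omega⟩
  have hupp : ∃ p ∈ S, u ≤ p.1 ∧ (u - p.1) % 2 = 0 := by
    obtain ⟨v, hv⟩ := hB.right
    by_cases hc : (u - b) % 2 = 0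
    · exact ⟨_, hv, h2, hc⟩
    · rcases hT.adj _ _ hv with (h | h) | h | h <;>
        exact ⟨_, h, by simp only; omega, by simp only; omega⟩
  obtain ⟨⟨p, p'⟩, hp, g1, g2⟩ := hlow
  obtain ⟨⟨q, q'⟩, hq, g3, g4⟩ := hupp
  simp only at g1 g2 g3 g4
  rcases Int.emod_two_eq_zero_or_one p with h | h
  · obtain ⟨v, hv⟩ := PlanarIso.exists_mem_col he (by rw [hE, span]; ring)
      (mem_evens.2 ⟨hp, h⟩) (mem_evens.2 ⟨hq, by omega⟩) g1 g3 (by simp only; omega)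
    exact ⟨v, (mem_evens.1 hv).1⟩
  · obtain ⟨v, hv⟩ := PlanarIso.exists_mem_col ho (by rw [hO, span]; ring)
      (mem_odds.2 ⟨hp, h⟩) (mem_odds.2 ⟨hq, by omega⟩) g1 g3 (by simp only; omega)
    exact ⟨v, (mem_odds.1 hv).1⟩

theorem span_evens_add_span_odds {S : Finset (ℤ × ℤ)} (hL : Lat S) :
    span (evens S) + span (odds S) = span S := by
  have h1 : ((evens S).image Prod.fst).card + ((odds S).image Prod.fst).card =
      (S.image Prod.fst).card := by
    rw [← Finset.card_union_of_disjoint, ← Finset.image_union, evens_union_odds]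
    rw [Finset.disjoint_left]
    rintro u hu hu'
    obtain ⟨⟨u, v⟩, h, rfl⟩ := Finset.mem_image.1 hu
    obtain ⟨⟨u', v'⟩, h', e⟩ := Finset.mem_image.1 hu'
    simp only at e
    have := (mem_evens.1 h).2
    have := (mem_odds.1 h').2
    omega
  have h2 : ((evens S).image Prod.snd).card + ((odds S).image Prod.snd).card =
      (S.image Prod.snd).card := by
    rw [← Finset.card_union_of_disjoint, ← Finset.image_union, evens_union_odds]
    rw [Finset.disjoint_left]
    rintro v hv hv'
    obtain ⟨⟨u, v⟩, h, rfl⟩ := Finset.mem_image.1 hv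
    obtain ⟨⟨u', v'⟩, h', e⟩ := Finset.mem_image.1 hv'
    simp only at e
    have g1 := mem_evens.1 h
    have g2 := mem_odds.1 h'
    have := hL.mem g1.1
    have := hL.mem g2.1
    omega
  unfold span
  omega

theorem span_eq_of_bounds {S : Finset (ℤ × ℤ)} {a b c d : ℤ} (hB : Bounds S a b c d)
    (hcol : ∀ u, a ≤ u → u ≤ b → ∃ v, (u, v) ∈ S) (hrow : ∀ v, c ≤ v → v ≤ d → ∃ u, (u, v) ∈ S) :
    (span S : ℤ) = (b - a) + (d - c) + 2 := by
  have h1 : S.image Prod.fst = Finset.Icc a b := by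
    ext u
    simp only [Finset.mem_image, Prod.exists, Finset.mem_Icc]
    constructor
    · rintro ⟨u', v, h, rfl⟩
      exact (hB.mem _ _ h).1
    · rintro ⟨h1, h2⟩
      obtain ⟨v, hv⟩ := hcol u h1 h2
      exact ⟨_, v, hv, rfl⟩
  have h2 : S.image Prod.snd = Finset.Icc c d := by
    ext v
    simp only [Finset.mem_image, Prod.exists, Finset.mem_Icc]
    constructor
    · rintro ⟨u, v', h, rfl⟩
      exact (hB.mem _ _ h).2
    · rintro ⟨h1, h2⟩
      obtain ⟨u, hu⟩ := hrow v h1 h2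
      exact ⟨u, _, hu, rfl⟩
  obtain ⟨v, hv⟩ := hB.left
  have h3 := (hB.mem _ _ hv)
  rw [span, h1, h2, Int.card_Icc, Int.card_Icc]
  omega

theorem bd_le_of_card_le_two {S : Finset (ℤ × ℤ)} (hS : MinF S) (h2 : S.card ≤ 2) :
    bd S ≤ 2 * S.card + 2 := by
  obtain ⟨T, hT, hc, hb⟩ := exists_card_eq_maxSize (2 * S.card)
  have : S.card ≤ maxSize (2 * S.card) := by
    generalize S.card = n at h2
    interval_cases n <;> decide
  have := hS.bd_le hT (by omega)
  omega

/-- A minimal set contained in one class of diagonals has at most two points, and these lie on a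
common diagonal. -/
theorem MinF.single_class {S : Finset (ℤ × ℤ)} (hS : MinF S) (hne : S.Nonempty)
    (h : evens S = ∅ ∨ odds S = ∅) {a b c d : ℤ} (hB : Bounds S a b c d) :
    S = rect a b c d ∧ (bd S : ℤ) = (b - a) + (d - c) + 4 := by
  have h1 := card_add_span_lt hne
  have h0 := hne.card_pos
  have h4 := four_mul_card_le_span S
  rw [← bd_of_single_class h] at h1
  have h2 : S.card ≤ 2 := by
    -- Three or more points in one class would fit under a boundary smaller by one.
    by_contra hc
    have e1 := le_maxSize_single' (s := bd S - 3) (by omega) h4 (by omega)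
    have e2 := hS.maxSize_lt (s := bd S - 3) (by omega)
    omega
  have h3 := bd_le_of_card_le_two hS h2
  have h5 : S.card + 1 ≤ span S := by
    by_contra hc
    have : span S * span S ≤ S.card * S.card := Nat.mul_le_mul (by omega) (by omega)
    nlinarith
  have hnb : (nb S).card = S.card + (S.image Prod.fst).card + (S.image Prod.snd).card + 1 := by
    rw [← bd_of_single_class h]
    unfold span at h1 h5
    omega
  have hpar : ∀ u v u' v', (u, v) ∈ S → (u', v') ∈ S → (u - u') % 2 = 0 ∧ (v - v') % 2 = 0 := by
    intro u v u' v' hp hp'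
    have g1 := hS.1.mem hp
    have g2 := hS.1.mem hp'
    have : (u % 2 = 0 ∧ u' % 2 = 0) ∨ (u % 2 = 1 ∧ u' % 2 = 1) := by
      rcases h with h | h
      · right
        have key : ∀ u v, (u, v) ∈ S → u % 2 = 1 := by
          intro u v hp
          rcases Int.emod_two_eq_zero_or_one u with h' | h'
          · exact absurd (mem_evens.2 ⟨hp, h'⟩) (by simp [h])
          · exact h'
        exact ⟨key _ _ hp, key _ _ hp'⟩
      · left
        have key : ∀ u v, (u, v) ∈ S → u % 2 = 0 := by
          intro u v hp
          rcases Int.emod_two_eq_zero_or_one u with h' | h'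
          · exact h'
          · exact absurd (mem_odds.2 ⟨hp, h'⟩) (by simp [h])
        exact ⟨key _ _ hp, key _ _ hp'⟩
    omega
  obtain ⟨va, ha⟩ := hB.left
  obtain ⟨vb, hb⟩ := hB.right
  obtain ⟨uc, hc⟩ := hB.bot
  obtain ⟨ud, hd⟩ := hB.top
  have hcard : S.card = 1 ∨ S.card = 2 := by omega
  have hspan : span S = S.card + 1 := by omega
  have h1or : (S.image Prod.fst).card = 1 ∨ (S.image Prod.snd).card = 1 := by
    have := (hne.image Prod.fst).card_pos
    have := (hne.image Prod.snd).card_pos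
    unfold span at hspan
    omega
  have hsub := hB.subset_rect hS.1
  have hcolle : ∀ R : Finset ℤ, R ⊆ S.image Prod.fst → R.card ≤ (S.image Prod.fst).card :=
    fun R hR => Finset.card_le_card hR
  have hrowle : ∀ R : Finset ℤ, R ⊆ S.image Prod.snd → R.card ≤ (S.image Prod.snd).card :=
    fun R hR => Finset.card_le_card hR
  have memf : ∀ u v, (u, v) ∈ S → u ∈ S.image Prod.fst := fun u v h =>
    Finset.mem_image_of_mem Prod.fst h
  have mems : ∀ u v, (u, v) ∈ S → v ∈ S.image Prod.snd := fun u v h =>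
    Finset.mem_image_of_mem Prod.snd h
  rcases h1or with hone | hone
  · have hall : ∀ u v, (u, v) ∈ S → u = a := fun u v h =>
      Finset.card_le_one.1 hone.le _ (memf _ _ h) _ (memf _ _ ha)
    obtain rfl := hall _ _ hb
    have hrow : ∀ v, c ≤ v → v ≤ d → (v - c) % 2 = 0 → (b, v) ∈ S := by
      intro v g1 g2 g3
      obtain ⟨u, hu⟩ := PlanarIso.exists_mem_row hne hnb hc hd g1 g2 (by simp only; omega)
      exact hall _ _ hu ▸ hu
    have hcpar := hS.1.mem (hrow c le_rfl (hB.mem _ _ hb |>.2.1.trans (hB.mem _ _ hb).2.2)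
      (by omega))
    have hdc := (hpar _ _ _ _ hd hc).2
    refine ⟨Finset.Subset.antisymm hsub ?_, ?_⟩
    · rintro ⟨u, v⟩ hp
      have hp := mem_rect.1 hp
      obtain rfl : u = b := by omega
      exact hrow v hp.1.2.1 hp.1.2.2 (by omega)
    · have hcd := (hB.mem _ _ hc).2.2
      have hsz : (S.image Prod.snd).card = S.card := by
        unfold span at hspan
        omega
      rcases hcard with hk | hk
      · have : c = d := Finset.card_le_one.1 (hsz.trans hk).le _ (mems _ _ hc) _ (mems _ _ hd)
        omega
      · have hne' : c ≠ d := by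
          intro hcd'
          have : S.image Prod.snd ⊆ {c} := by
            intro v hv
            obtain ⟨⟨u, v'⟩, g, rfl⟩ := Finset.mem_image.1 hv
            have := (hB.mem _ _ g).2
            simp only [Finset.mem_singleton]
            omega
          have := Finset.card_le_card this
          simp only [Finset.card_singleton] at this
          omega
        have hd2 : d = c + 2 := by
          by_contra hd2
          have e := hrowle {c, c + 2, d} (by
            intro v hv
            simp only [Finset.mem_insert, Finset.mem_singleton] at hv
            rcases hv with rfl | rfl | rfl
            · exact mems _ _ hc
            · exact mems _ _ (hrow (c + 2) (by omega) (by omega) (by omega))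
            · exact mems _ _ hd)
          rw [Finset.card_eq_three.2 ⟨c, c + 2, d, by omega, by omega, by omega, rfl⟩] at e
          omega
        omega
  · have hall : ∀ u v, (u, v) ∈ S → v = c := fun u v h =>
      Finset.card_le_one.1 hone.le _ (mems _ _ h) _ (mems _ _ hc)
    obtain rfl := hall _ _ hd
    have hcol : ∀ u, a ≤ u → u ≤ b → (u - a) % 2 = 0 → (u, d) ∈ S := by
      intro u g1 g2 g3
      obtain ⟨v, hv⟩ := PlanarIso.exists_mem_col hne hnb ha hb g1 g2 (by simp only; omega)
      exact hall _ _ hv ▸ hv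
    have hcpar := hS.1.mem (hcol a le_rfl (hB.mem _ _ hd |>.1.1.trans (hB.mem _ _ hd).1.2)
      (by omega))
    have hdc := (hpar _ _ _ _ hb ha).1
    refine ⟨Finset.Subset.antisymm hsub ?_, ?_⟩
    · rintro ⟨u, v⟩ hp
      have hp := mem_rect.1 hp
      obtain rfl : v = d := by omega
      exact hcol u hp.1.1.1 hp.1.1.2 (by omega)
    · have hcd := (hB.mem _ _ ha).1.2
      have hsz : (S.image Prod.fst).card = S.card := by
        unfold span at hspan
        omega
      rcases hcard with hk | hk
      · have : a = b := Finset.card_le_one.1 (hsz.trans hk).le _ (memf _ _ ha) _ (memf _ _ hb)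
        omega
      · have hne' : a ≠ b := by
          intro hcd'
          have : S.image Prod.fst ⊆ {a} := by
            intro v hv
            obtain ⟨⟨u, v'⟩, g, rfl⟩ := Finset.mem_image.1 hv
            have := (hB.mem _ _ g).1
            simp only [Finset.mem_singleton]
            omega
          have := Finset.card_le_card this
          simp only [Finset.card_singleton] at this
          omega
        have hd2 : b = a + 2 := by
          by_contra hd2
          have e := hcolle {a, a + 2, b} (by
            intro v hv
            simp only [Finset.mem_insert, Finset.mem_singleton] at hv
            rcases hv with rfl | rfl | rfl
            · exact memf _ _ ha
            · exact memf _ _ (hcol (a + 2) (by omega) (by omega) (by omega))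
            · exact memf _ _ hb)
          rw [Finset.card_eq_three.2 ⟨a, a + 2, b, by omega, by omega, by omega, rfl⟩] at e
          omega
        omega

theorem nonempty_classes {S : Finset (ℤ × ℤ)} (h : ¬ (evens S = ∅ ∨ odds S = ∅)) :
    (evens S).Nonempty ∧ (odds S).Nonempty := by
  rwa [not_or, ← ne_eq, ← ne_eq, ← Finset.nonempty_iff_ne_empty,
    ← Finset.nonempty_iff_ne_empty] at h

theorem Bounds.nonempty {S : Finset (ℤ × ℤ)} {a b c d : ℤ} (hB : Bounds S a b c d) :
    S.Nonempty := hB.left.elim fun _ h => ⟨_, h⟩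

/-- The boundary of a minimal set has the size of the boundary of its bounding box. -/
theorem MinF.bd_eq {S : Finset (ℤ × ℤ)} (hS : MinF S) {a b c d : ℤ} (hB : Bounds S a b c d) :
    (bd S : ℤ) = (b - a) + (d - c) + 4 := by
  by_cases h : evens S = ∅ ∨ odds S = ∅
  · exact (hS.single_class hB.nonempty h hB).2
  · obtain ⟨he, ho⟩ := nonempty_classes h
    have h1 := (hS.card_nb_evens he ho).1
    have h2 := span_eq_of_bounds hB (fun u => hS.exists_mem_col he ho hB)
      (fun v => hS.exists_mem_row he ho hB)
    rw [span_evens_add_span_odds hS.1] at h1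
    omega

theorem MinF.exists_insert {S : Finset (ℤ × ℤ)} (hS : MinF S) {a b c d : ℤ}
    (hB : Bounds S a b c d) (hne : S ≠ rect a b c d) :
    ∃ x ∈ rect a b c d, x ∉ S ∧ bd (insert x S) ≤ bd S := by
  by_cases h : evens S = ∅ ∨ odds S = ∅
  · exact absurd (hS.single_class hB.nonempty h hB).1 hne
  · obtain ⟨he, ho⟩ := nonempty_classes h
    exact (hS.tight he ho).exists_insert hB (fun v => hS.exists_mem_row he ho hB) hne

/-- A minimal set can be enlarged by one point inside its bounding box. -/
theorem MinF.exists_minF_insert {S : Finset (ℤ × ℤ)} (hS : MinF S) {a b c d : ℤ}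
    (hB : Bounds S a b c d) (hne : S ≠ rect a b c d) :
    ∃ x ∈ rect a b c d, x ∉ S ∧ MinF (insert x S) ∧ bd (insert x S) ≤ bd S := by
  obtain ⟨x, hx, hxS, hle⟩ := hS.exists_insert hB hne
  exact ⟨x, hx, hxS, hS.of_bd_le (hS.1.insert (lat_rect _ _ _ _ _ hx))
    (Finset.card_le_card (Finset.subset_insert _ _)) hle, hle⟩

/-- Insert missing points one at a time, by induction on their number; the bounding rectangle does
not change. -/
theorem MinF.rect {S : Finset (ℤ × ℤ)} (hS : MinF S) {a b c d : ℤ} (hB : Bounds S a b c d) :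
    MinF (rect a b c d) ∧ bd (PlanarIso.rect a b c d) ≤ bd S := by
  obtain ⟨k, hk⟩ := Nat.exists_eq_add_of_le (Finset.card_le_card (hB.subset_rect hS.1))
  induction k generalizing S with
  | zero =>
    rw [← Finset.eq_of_subset_of_card_le (hB.subset_rect hS.1) (by omega)]
    exact ⟨hS, le_rfl⟩
  | succ k ih =>
    obtain ⟨x, hx, hxS, hmin, hle⟩ := hS.exists_minF_insert hB (by rintro rfl; omega)
    obtain ⟨h1, h2⟩ := ih hmin (hB.insert hx) (by rw [Finset.card_insert_of_notMem hxS]; omega)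
    exact ⟨h1, h2.trans hle⟩

/-! ### Growing beyond a box. -/

theorem rect_image_swap (a b c d : ℤ) : (rect a b c d).image Prod.swap = rect c d a b := by
  ext ⟨u, v⟩
  rw [mem_image_swap, mem_rect, mem_rect, add_comm v u]
  tauto

theorem bd_image_swap (S : Finset (ℤ × ℤ)) : bd (S.image Prod.swap) = bd S := by
  rw [bd, nb_image_swap, ← Finset.image_sdiff _ _ Prod.swap_injective, card_image_swap, bd]

theorem Bounds.swap {S : Finset (ℤ × ℤ)} {a b c d : ℤ} (h : Bounds S a b c d) :
    Bounds (S.image Prod.swap) c d a b where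
  mem _ _ hp := (h.mem _ _ (mem_image_swap.1 hp)).symm
  left := h.bot.imp fun _ => mem_image_swap.2
  right := h.top.imp fun _ => mem_image_swap.2
  bot := h.left.imp fun _ => mem_image_swap.2
  top := h.right.imp fun _ => mem_image_swap.2

theorem Bounds.rect {S : Finset (ℤ × ℤ)} {a b c d : ℤ} (h : Bounds S a b c d) (hL : Lat S) :
    Bounds (rect a b c d) a b c d where
  mem _ _ hp := (mem_rect.1 hp).1
  left := h.left.imp fun _ hp => h.subset_rect hL hp
  right := h.right.imp fun _ hp => h.subset_rect hL hp
  bot := h.bot.imp fun _ hp => h.subset_rect hL hp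
  top := h.top.imp fun _ hp => h.subset_rect hL hp

theorem mem_nb_of_mem {S : Finset (ℤ × ℤ)} {u v u' v' : ℤ} (h : (u', v') ∈ S)
    (hu : u' = u - 1 ∨ u' = u + 1) (hv : v' = v - 1 ∨ v' = v + 1) : (u, v) ∈ nb S :=
  mem_nb.2 (HasNb.intro (P := fun u v => (u, v) ∈ S) h hu hv)

/-- Starting a new column next to a box adds only one to the boundary. -/
theorem exists_bd_insert_col_le {a b c d : ℤ} (hB : Bounds (rect a b c d) a b c d) (hcd : c < d)
    {e f : ℤ} (he : (e = b + 1 ∧ f = b) ∨ (e = a - 1 ∧ f = a)) :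
    ∃ v, (c ≤ v ∧ v ≤ d) ∧ (e + v) % 2 = 0 ∧
      bd (insert (e, v) (rect a b c d)) ≤ bd (rect a b c d) + 1 := by
  obtain ⟨v, hv, hev⟩ : ∃ v, (v = c ∨ v = c + 1) ∧ (e + v) % 2 = 0 := by
    rcases Int.emod_two_eq_zero_or_one (e + c) with h | h
    · exact ⟨c, Or.inl rfl, h⟩
    · exact ⟨c + 1, Or.inr rfl, by omega⟩
  refine ⟨v, by omega, hev, ?_⟩
  obtain ⟨ul, hul⟩ := hB.left
  obtain ⟨ur, hur⟩ := hB.right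
  obtain ⟨ub, hub⟩ := hB.bot
  obtain ⟨ut, hut⟩ := hB.top
  rw [mem_rect] at hul hur hub hut
  have hx : (e, v) ∉ rect a b c d := by rw [mem_rect]; omega
  have hx' : (e, v) ∈ nb (rect a b c d) := by
    have hab : a ≤ f ∧ f ≤ b := by omega
    rcases hv with rfl | rfl
    · exact mem_nb_of_mem (mem_rect.2 ⟨⟨hab, by omega, by omega⟩, by omega⟩ :
        (f, v + 1) ∈ rect a b v d) (by omega) (by omega)
    · exact mem_nb_of_mem (mem_rect.2 ⟨⟨hab, by omega, by omega⟩, by omega⟩ :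
        (f, c) ∈ rect a b c d) (by omega) (by omega)
  have hF : nb {(e, v)} ⊆ nb (rect a b c d) ∪ rect a b c d ∪
      {(2 * e - f, v - 1), (2 * e - f, v + 1)} := by
    rintro ⟨u', v'⟩ hp
    simp only [mem_nb, Finset.mem_singleton, Prod.mk.injEq] at hp
    have h1 : u' = f ∨ u' = 2 * e - f := by omega
    have h2 : v' = v - 1 ∨ v' = v + 1 := by omega
    clear hp
    rcases h1 with rfl | rfl
    · refine Finset.mem_union_left _ ?_
      by_cases hin : c ≤ v' ∧ v' ≤ d
      · exact Finset.mem_union_right _ (mem_rect.2 ⟨⟨by omega, hin⟩, by omega⟩)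
      -- The point of the box on its bottom or top side in row `v` cannot be in column `f`, by
      -- parity. So there is a column next to `f` inside the box, namely `2 * u' - e`.
      · have hab : a < b := by
          have : v = c ∨ v = d := by omega
          rcases this with rfl | rfl <;> omega
        exact Finset.mem_union_left _ (mem_nb_of_mem (mem_rect.2 ⟨by omega, by omega⟩ :
          (2 * u' - e, v) ∈ rect a b c d) (by omega) (by omega))
    · refine Finset.mem_union_right _ ?_
      rcases h2 with rfl | rfl <;> simp
  have := bd_insert_le_of_card hx hx' hF
  have := Finset.card_le_two (a := (2 * e - f, v - 1)) (b := (2 * e - f, v + 1))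
  omega

theorem image_swap_insert (u v : ℤ) (S : Finset (ℤ × ℤ)) :
    (insert (u, v) S).image Prod.swap = insert (v, u) (S.image Prod.swap) := by
  rw [Finset.image_insert]; rfl

theorem exists_bd_insert_le {a b c d : ℤ} (hB : Bounds (rect a b c d) a b c d)
    (hne : a < b ∨ c < d) : ∃ z ∉ rect a b c d, (z.1 + z.2) % 2 = 0 ∧
      bd (insert z (rect a b c d)) ≤ bd (rect a b c d) + 1 := by
  rcases hne with h | h
  · have hB' := hB.swap
    rw [rect_image_swap] at hB'
    obtain ⟨v, h1, h2, h3⟩ := exists_bd_insert_col_le hB' h (Or.inl ⟨rfl, rfl⟩)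
    refine ⟨(v, d + 1), by rw [mem_rect]; omega, by simp only; omega, ?_⟩
    rw [← bd_image_swap, image_swap_insert, rect_image_swap, ← bd_image_swap (rect a b c d),
      rect_image_swap]
    exact h3
  · obtain ⟨v, h1, h2, h3⟩ := exists_bd_insert_col_le hB h (Or.inl ⟨rfl, rfl⟩)
    exact ⟨_, by rw [mem_rect]; omega, h2, h3⟩

theorem le_card_col {e c d : ℤ} {n : ℕ} (hn : (n : ℤ) = d - c + 1) :
    n / 2 ≤ (rect e e c d).card ∧ ((e + c) % 2 = 0 → (n + 1) / 2 ≤ (rect e e c d).card) := by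
  rcases Int.emod_two_eq_zero_or_one (e + c) with h | h
  · have := (card_rect_col e c n h).1
    rw [show c + (n : ℤ) - 1 = d by omega] at this
    omega
  · have := (card_rect_col e (c + 1) n (by omega)).2
    rw [show c + 1 + (n : ℤ) - 2 = d by omega, show c + 1 - 1 = c by ring] at this
    omega

theorem card_rect_sub_col {a b c d : ℤ} (h : a ≤ b + 1) :
    (rect (a - 1) b c d).card = (rect a b c d).card + (rect (a - 1) (a - 1) c d).card := by
  rw [← Finset.card_union_of_disjoint]
  · congr 1
    ext ⟨u, v⟩
    simp only [mem_rect, Finset.mem_union]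
    omega
  · rw [Finset.disjoint_left]
    rintro ⟨u, v⟩ h1 h2
    simp only [mem_rect] at h1 h2
    omega

theorem Bounds.insert_rightCol {a b c d v : ℤ} (hB : Bounds (PlanarIso.rect a b c d) a b c d)
    (hv : c ≤ v ∧ v ≤ d) :
    Bounds (Insert.insert (b + 1, v) (PlanarIso.rect a b c d)) a (b + 1) c d where
  mem u w hp := by
    obtain ⟨_, h⟩ := hB.left
    have := mem_rect.1 h
    simp only [Finset.mem_insert, Prod.mk.injEq, mem_rect] at hp
    omega
  left := hB.left.imp fun _ => Finset.mem_insert_of_mem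
  right := ⟨v, Finset.mem_insert_self _ _⟩
  bot := hB.bot.imp fun _ => Finset.mem_insert_of_mem
  top := hB.top.imp fun _ => Finset.mem_insert_of_mem

theorem Bounds.insert_leftCol {a b c d v : ℤ} (hB : Bounds (PlanarIso.rect a b c d) a b c d)
    (hv : c ≤ v ∧ v ≤ d) :
    Bounds (Insert.insert (a - 1, v) (PlanarIso.rect a b c d)) (a - 1) b c d where
  mem u w hp := by
    obtain ⟨_, h⟩ := hB.left
    have := mem_rect.1 h
    simp only [Finset.mem_insert, Prod.mk.injEq, mem_rect] at hp
    omega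
  left := ⟨v, Finset.mem_insert_self _ _⟩
  right := hB.right.imp fun _ => Finset.mem_insert_of_mem
  bot := hB.bot.imp fun _ => Finset.mem_insert_of_mem
  top := hB.top.imp fun _ => Finset.mem_insert_of_mem

/-- A new column is placed along a longest side, of length `n`, so `s ≤ 2 * n` and `maxSize`
increases by about `n / 2` at most. When `s` and `n` are odd, the width is even and the two adjacent
columns start with opposite parity, so one of them has the required `(n + 1) / 2` points. -/
theorem exists_grow_of_le {a b c d : ℤ} (hB : Bounds (rect a b c d) a b c d) {s : ℕ}
    (hs : (s : ℤ) = (b - a) + (d - c) + 2) (hmax : maxSize s ≤ (rect a b c d).card)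
    (hcd : c < d) (hle : b - a ≤ d - c) :
    ∃ y ∉ rect a b c d, ∃ a' b' c' d', (y.1 + y.2) % 2 = 0 ∧
      bd (insert y (rect a b c d)) ≤ bd (rect a b c d) + 1 ∧
      Bounds (insert y (rect a b c d)) a' b' c' d' ∧
      maxSize (s + 1) ≤ (rect a' b' c' d').card := by
  have hab : a ≤ b := by
    obtain ⟨_, h⟩ := hB.left
    have := (hB.mem _ _ h).1
    omega
  obtain ⟨n, hn⟩ := Int.eq_ofNat_of_zero_le (by omega : 0 ≤ d - c + 1)
  have e1 := fun h => maxSize_succ_le_of_even (s := s) (b := n) h (by omega)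
  have e2 := fun h => maxSize_succ_le_of_odd (s := s) (b := n) h (by omega)
  have hr := le_card_col (e := b + 1) hn.symm
  have hl := le_card_col (e := a - 1) hn.symm
  by_cases h : s % 2 = 0 ∨ (b + 1 + c) % 2 = 0 ∨ n % 2 = 0
  · obtain ⟨v, h1, h2, h3⟩ := exists_bd_insert_col_le hB hcd (Or.inl ⟨rfl, rfl⟩)
    refine ⟨(b + 1, v), by rw [mem_rect]; omega, a, b + 1, c, d, h2, h3, hB.insert_rightCol h1, ?_⟩
    rw [card_rect_add_col (by omega)]
    rcases Nat.mod_two_eq_zero_or_one s with h' | h'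
    · have := e1 h'
      omega
    · have := e2 h'
      omega
  · obtain ⟨v, h1, h2, h3⟩ := exists_bd_insert_col_le hB hcd (Or.inr ⟨rfl, rfl⟩)
    refine ⟨(a - 1, v), by rw [mem_rect]; omega, a - 1, b, c, d, h2, h3, hB.insert_leftCol h1, ?_⟩
    rw [card_rect_sub_col (by omega)]
    have := e2 (by omega)
    have := hl.2 (by omega)
    omega

/-- A box of maximal size can be started to grow in such a way that the larger box is again of
maximal size. -/
theorem exists_grow {a b c d : ℤ} (hB : Bounds (rect a b c d) a b c d) {s : ℕ}
    (hs : (s : ℤ) = (b - a) + (d - c) + 2) (hmax : maxSize s ≤ (rect a b c d).card)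
    (hne : a < b ∨ c < d) :
    ∃ y ∉ rect a b c d, ∃ a' b' c' d', (y.1 + y.2) % 2 = 0 ∧
      bd (insert y (rect a b c d)) ≤ bd (rect a b c d) + 1 ∧
      Bounds (insert y (rect a b c d)) a' b' c' d' ∧
      maxSize (s + 1) ≤ (rect a' b' c' d').card := by
  rcases le_total (b - a) (d - c) with h | h
  · exact exists_grow_of_le hB hs hmax (by omega) h
  · have hB' := hB.swap
    rw [rect_image_swap] at hB'
    rw [← card_image_swap, rect_image_swap] at hmax
    obtain ⟨⟨v, u⟩, h1, c', d', a', b', h2, h3, h4, h5⟩ :=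
      exists_grow_of_le hB' (s := s) (by omega) hmax (by omega) h
    refine ⟨(u, v), ?_, a', b', c', d', by simp only at h2 ⊢; omega, ?_, ?_, ?_⟩
    · rwa [← rect_image_swap, mem_image_swap] at h1
    · rwa [← bd_image_swap, image_swap_insert, rect_image_swap, ← bd_image_swap (rect a b c d),
        rect_image_swap]
    · have := h4.swap
      rwa [image_swap_insert, rect_image_swap] at this
    · rwa [← card_image_swap, rect_image_swap]

theorem Bounds.mono {S T : Finset (ℤ × ℤ)} {a b c d a' b' c' d' : ℤ} (hS : Bounds S a b c d)
    (hT : Bounds T a' b' c' d') (h : S ⊆ T) : (a' ≤ a ∧ b ≤ b') ∧ c' ≤ c ∧ d ≤ d' := by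
  obtain ⟨_, h1⟩ := hS.left
  obtain ⟨_, h2⟩ := hS.right
  obtain ⟨_, h3⟩ := hS.bot
  obtain ⟨_, h4⟩ := hS.top
  exact ⟨⟨(hT.mem _ _ (h h1)).1.1, (hT.mem _ _ (h h2)).1.2⟩, (hT.mem _ _ (h h3)).2.1,
    (hT.mem _ _ (h h4)).2.2⟩

/-- If a minimal set can be enlarged outside its bounding box, so can the box. -/
theorem MinF.insert_boundingRect {S : Finset (ℤ × ℤ)} (hS : MinF S) {a b c d : ℤ}
    (hB : Bounds S a b c d) {x : ℤ × ℤ} (hx : x ∉ PlanarIso.rect a b c d)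
    (hxS : MinF (insert x S)) : MinF (insert x (PlanarIso.rect a b c d)) := by
  have hsub := hB.subset_rect hS.1
  -- Submodularity, with `bd rect ≤ bd S`, gives `bd (insert x rect) ≤ bd (insert x S)`, and the
  -- larger set inherits minimality.
  have h1 := bd_insert_add_le hsub hx
  have h2 := (hS.rect hB).2
  refine hxS.of_bd_le ((lat_rect _ _ _ _).insert (hxS.1 _ (Finset.mem_insert_self _ _)))
    (Finset.card_le_card (Finset.insert_subset_insert _ hsub)) (by omega)

/-- A minimal box that is not dead can be enlarged so that the new bounding box is not dead. -/
theorem exists_insert_rect_not_dead {a b c d : ℤ} (hB : Bounds (rect a b c d) a b c d)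
    (hmin : MinF (rect a b c d)) {x : ℤ × ℤ} (hx : x ∉ rect a b c d)
    (hxmin : MinF (insert x (rect a b c d))) :
    ∃ y ∉ rect a b c d, MinF (insert y (rect a b c d)) ∧ ∃ a' b' c' d',
      Bounds (insert y (rect a b c d)) a' b' c' d' ∧
      ∃ z ∉ rect a' b' c' d', MinF (insert z (rect a' b' c' d')) := by
  have hord : a ≤ b ∧ c ≤ d := by
    obtain ⟨_, h⟩ := hB.left
    have := hB.mem _ _ h
    omega
  obtain ⟨s, hs⟩ := Int.eq_ofNat_of_zero_le (by omega : 0 ≤ (b - a) + (d - c) + 2)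
  have hbd := hmin.bd_eq hB
  -- Were the boundary not larger, `MinF.bd_eq` would give the same bounding rectangle, which would
  -- then contain `x`.
  have hlt : bd (rect a b c d) < bd (insert x (rect a b c d)) := by
    obtain ⟨a₁, b₁, c₁, d₁, hB₁⟩ := exists_bounds (Finset.insert_nonempty x (rect a b c d))
    have h1 := hxmin.bd_eq hB₁
    have h2 := hB.mono hB₁ (Finset.subset_insert _ _)
    by_contra hle
    apply hx
    obtain ⟨u, v⟩ := x
    have h3 := hB₁.mem u v (Finset.mem_insert_self _ _)
    exact mem_rect.2 ⟨by omega, hxmin.1 _ (Finset.mem_insert_self _ _)⟩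
  -- Being extendable means that `card + 1` points do not fit under the boundary `s + 2` of the box.
  have hmax : maxSize s ≤ (rect a b c d).card := by
    have := hxmin.maxSize_lt (s := s) (by omega)
    rw [Finset.card_insert_of_notMem hx] at this
    omega
  by_cases hne : a < b ∨ c < d
  · obtain ⟨y, hy, a', b', c', d', h1, h2, h3, h4⟩ := exists_grow hB hs.symm hmax hne
    have hymin : MinF (insert y (rect a b c d)) := by
      refine minF_of_maxSize_lt ((lat_rect _ _ _ _).insert h1) (s := s) (by omega) ?_
      rw [Finset.card_insert_of_notMem hy]
      omega
    refine ⟨y, hy, hymin, a', b', c', d', h3, ?_⟩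
    have h5 := (hymin.rect h3).2
    have h6 := hB.mono h3 (Finset.subset_insert _ _)
    -- The new rectangle has boundary at most `s + 3` and at least `maxSize (s + 1)` points, so one
    -- more point at cost one exceeds the threshold.
    obtain ⟨z, hz, h7, h8⟩ := exists_bd_insert_le (h3.rect hymin.1) (by omega)
    refine ⟨z, hz, minF_of_maxSize_lt ((lat_rect _ _ _ _).insert h7) (s := s + 1) (by omega) ?_⟩
    rw [Finset.card_insert_of_notMem hz]
    omega
  -- A single point is exceptional: a diagonal step enlarges the rectangle in both directions and
  -- raises the boundary from `4` to at most `6`.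
  · obtain ⟨rfl, rfl⟩ : a = b ∧ c = d := by omega
    have hac : (a + c) % 2 = 0 := by
      obtain ⟨_, h⟩ := hB.left
      have := mem_rect.1 h
      omega
    have hy : (a + 1, c + 1) ∉ rect a a c c := by rw [mem_rect]; omega
    have hymin : MinF (insert (a + 1, c + 1) (rect a a c c)) := by
      refine minF_of_maxSize_lt ((lat_rect _ _ _ _).insert (by simp only; omega)) (s := 3) ?_ ?_
      · have hy' : (a + 1, c + 1) ∈ nb (rect a a c c) := by
          simp only [mem_nb, mem_rect]
          omega
        have hF : nb {(a + 1, c + 1)} ⊆ nb (rect a a c c) ∪ rect a a c c ∪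
            {(a, c + 2), (a + 2, c), (a + 2, c + 2)} := by
          rintro ⟨u, v⟩ hp
          simp only [mem_nb, Finset.mem_singleton, Prod.mk.injEq] at hp
          simp only [Finset.mem_union, Finset.mem_insert, Finset.mem_singleton, Prod.mk.injEq,
            mem_rect]
          omega
        have := bd_insert_le_of_card hy hy' hF
        have := Finset.card_le_three (a := (a, c + 2)) (b := (a + 2, c)) (c := (a + 2, c + 2))
        omega
      · rw [Finset.card_insert_of_notMem hy]
        have := hB.nonempty.card_pos
        have : maxSize 3 = 1 := rfl
        omega
    have h3 : Bounds (insert (a + 1, c + 1) (rect a a c c)) a (a + 1) c (c + 1) := by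
      refine ⟨fun u v hp => ?_, hB.left.imp fun _ => Finset.mem_insert_of_mem,
        ⟨_, Finset.mem_insert_self _ _⟩, hB.bot.imp fun _ => Finset.mem_insert_of_mem,
        ⟨_, Finset.mem_insert_self _ _⟩⟩
      simp only [Finset.mem_insert, Prod.mk.injEq, mem_rect] at hp
      omega
    refine ⟨_, hy, hymin, _, _, _, _, h3, ?_⟩
    have h5 := hymin.bd_eq h3
    have h6 := (hymin.rect h3).2
    have h9 := Finset.card_le_card (h3.subset_rect hymin.1)
    rw [Finset.card_insert_of_notMem hy] at h9
    have h10 := hB.nonempty.card_pos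
    obtain ⟨z, hz, h7, h8⟩ := exists_bd_insert_le (h3.rect hymin.1) (by omega)
    refine ⟨z, hz, minF_of_maxSize_lt ((lat_rect _ _ _ _).insert h7) (s := 4) (by omega) ?_⟩
    rw [Finset.card_insert_of_notMem hz]
    have : maxSize 4 = 2 := rfl
    omega

/-! ### Translation between the plane and the diagonal lattice. -/

/-- The coordinates in which boxes are rectangles. -/
def diag (p : ℤ × ℤ) : ℤ × ℤ := (p.2 - p.1, p.2 + p.1)

theorem diag_injective : Function.Injective diag := by
  rintro ⟨a, b⟩ ⟨c, d⟩ h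
  simp only [diag, Prod.mk.injEq] at h ⊢
  omega

/-- The set of vertices whose diagonal coordinates lie in `S`. -/
def pts (S : Finset (ℤ × ℤ)) : Set (ℤ × ℤ) := diag ⁻¹' S

theorem mem_pts {S : Finset (ℤ × ℤ)} {p : ℤ × ℤ} : p ∈ pts S ↔ (p.2 - p.1, p.2 + p.1) ∈ S :=
  Iff.rfl

theorem finite_pts (S : Finset (ℤ × ℤ)) : (pts S).Finite :=
  S.finite_toSet.preimage diag_injective.injOn

theorem exists_diag_eq {u v : ℤ} (h : (u + v) % 2 = 0) : ∃ p, diag p = (u, v) :=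
  ⟨((v - u) / 2, (u + v) / 2), by simp only [diag, Prod.mk.injEq]; omega⟩

theorem ncard_pts {S : Finset (ℤ × ℤ)} (hS : Lat S) : (pts S).ncard = S.card := by
  rw [pts, Set.ncard_preimage_of_injective_subset_range diag_injective, Set.ncard_coe_finset]
  rintro ⟨u, v⟩ h
  exact exists_diag_eq (hS _ h)

theorem exists_pts_eq {A : Set (ℤ × ℤ)} (hA : A.Finite) : ∃ S, Lat S ∧ pts S = A := by
  refine ⟨hA.toFinset.image diag, ?_, ?_⟩
  · intro p hp
    obtain ⟨q, -, rfl⟩ := Finset.mem_image.1 hp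
    simp only [diag]
    omega
  · rw [pts, Finset.coe_image, Set.preimage_image_eq _ diag_injective, Set.Finite.coe_toFinset]

theorem pts_subset_pts {S T : Finset (ℤ × ℤ)} (hS : Lat S) : pts S ⊆ pts T ↔ S ⊆ T := by
  constructor
  · rintro h ⟨u, v⟩ hp
    obtain ⟨p, hp'⟩ := exists_diag_eq (hS _ hp)
    have : p ∈ pts T := h (show diag p ∈ S by rwa [hp'])
    rw [← hp']
    exact this
  · exact fun h => Set.preimage_mono (by exact_mod_cast h)

theorem latticeGraph_adj_iff {p q : ℤ × ℤ} : latticeGraph.Adj p q ↔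
    ((q.2 - q.1 = p.2 - p.1 - 1 ∨ q.2 - q.1 = p.2 - p.1 + 1) ∧
      (q.2 + q.1 = p.2 + p.1 - 1 ∨ q.2 + q.1 = p.2 + p.1 + 1)) := by
  change |p.1 - q.1| + |p.2 - q.2| = 1 ↔ _
  rcases abs_cases (p.1 - q.1) with h | h <;> rcases abs_cases (p.2 - q.2) with h' | h' <;> omega

theorem vertexBoundary_pts {S : Finset (ℤ × ℤ)} (hS : Lat S) :
    vertexBoundary (pts S) = pts (nb S \ S) := by
  ext p
  simp only [vertexBoundary, Set.mem_ofPred_eq, mem_pts, Finset.mem_sdiff, mem_nb]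
  rw [and_comm]
  refine and_congr_left fun _ => ?_
  constructor
  · rintro ⟨q, hq, hadj⟩
    obtain ⟨h1 | h1, h2 | h2⟩ := latticeGraph_adj_iff.1 hadj <;> rw [h1, h2] at hq <;> tauto
  · have key : ∀ u v, (u, v) ∈ S → (u = p.2 - p.1 - 1 ∨ u = p.2 - p.1 + 1) →
        (v = p.2 + p.1 - 1 ∨ v = p.2 + p.1 + 1) →
        ∃ q : ℤ × ℤ, (q.2 - q.1, q.2 + q.1) ∈ S ∧ latticeGraph.Adj p q := by
      intro u v h hu hv
      obtain ⟨q, hq⟩ := exists_diag_eq (hS _ h)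
      simp only [diag] at hq
      refine ⟨q, hq ▸ h, latticeGraph_adj_iff.2 ?_⟩
      simp only [Prod.mk.injEq] at hq
      rw [hq.1, hq.2]
      exact ⟨hu, hv⟩
    rintro ((h | h) | h | h)
    · exact key _ _ h (Or.inl rfl) (Or.inl rfl)
    · exact key _ _ h (Or.inl rfl) (Or.inr rfl)
    · exact key _ _ h (Or.inr rfl) (Or.inl rfl)
    · exact key _ _ h (Or.inr rfl) (Or.inr rfl)

theorem lat_nb {S : Finset (ℤ × ℤ)} (hS : Lat S) : Lat (nb S) := by
  rintro ⟨u, v⟩ h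
  rcases mem_nb.1 h with (h | h) | h | h <;> have := hS.mem h <;> simp only <;> omega

theorem ncard_vertexBoundary_pts {S : Finset (ℤ × ℤ)} (hS : Lat S) :
    (vertexBoundary (pts S)).ncard = bd S := by
  rw [vertexBoundary_pts hS, ncard_pts ((lat_nb hS).subset Finset.sdiff_subset), bd]

theorem isMinimal_pts {S : Finset (ℤ × ℤ)} (hS : Lat S) : IsMinimal (pts S) ↔ MinF S := by
  constructor
  · rintro ⟨-, h⟩
    refine ⟨hS, fun T hT hc => ?_⟩
    have := h (pts T) (finite_pts T) (by rw [ncard_pts hT, ncard_pts hS, hc])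
    rwa [ncard_vertexBoundary_pts hS, ncard_vertexBoundary_pts hT] at this
  · rintro ⟨-, h⟩
    refine ⟨finite_pts S, fun B hB hc => ?_⟩
    obtain ⟨T, hT, rfl⟩ := exists_pts_eq hB
    rw [ncard_vertexBoundary_pts hS, ncard_vertexBoundary_pts hT]
    rw [ncard_pts hT, ncard_pts hS] at hc
    exact h T hT hc

theorem exists_minF_of_isMinimal {A : Set (ℤ × ℤ)} (hA : IsMinimal A) :
    ∃ S, MinF S ∧ pts S = A := by
  obtain ⟨S, hS, rfl⟩ := exists_pts_eq hA.1
  exact ⟨S, (isMinimal_pts hS).1 hA, rfl⟩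

theorem nonempty_of_nonempty_pts {S : Finset (ℤ × ℤ)} (h : (pts S).Nonempty) : S.Nonempty :=
  h.elim fun _ hp => ⟨_, hp⟩

theorem Bounds.pts_nonempty {S : Finset (ℤ × ℤ)} {a b c d : ℤ} (h : Bounds S a b c d)
    (hL : Lat S) : (pts S).Nonempty := by
  obtain ⟨v, hv⟩ := h.left
  obtain ⟨p, hp⟩ := exists_diag_eq (hL _ hv)
  exact ⟨p, show diag p ∈ S by rwa [hp]⟩

theorem pts_rect (a b c d : ℤ) : pts (rect a b c d) = boxSet a b c d := by
  ext p
  simp only [mem_pts, mem_rect, boxSet, Set.mem_ofPred_eq]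
  omega

theorem enc_pts {S : Finset (ℤ × ℤ)} (hL : Lat S) {a b c d : ℤ} (hB : Bounds S a b c d) :
    enc (pts S) = pts (rect a b c d) := by
  have hne := hB.pts_nonempty hL
  have hsub : pts S ⊆ pts (rect a b c d) := (pts_subset_pts hL).2 (hB.subset_rect hL)
  refine (isLeast_enc (finite_pts S) hne).unique
    ⟨⟨⟨hne.mono hsub, a, b, c, d, pts_rect a b c d⟩, hsub⟩, ?_⟩
  rintro B ⟨⟨-, a', b', c', d', rfl⟩, hAB⟩
  rw [← pts_rect, pts_subset_pts hL] at hAB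
  rw [← pts_rect, pts_subset_pts (lat_rect a b c d)]
  obtain ⟨_, h1⟩ := hB.left
  obtain ⟨_, h2⟩ := hB.right
  obtain ⟨_, h3⟩ := hB.bot
  obtain ⟨_, h4⟩ := hB.top
  have h1 := mem_rect.1 (hAB h1)
  have h2 := mem_rect.1 (hAB h2)
  have h3 := mem_rect.1 (hAB h3)
  have h4 := mem_rect.1 (hAB h4)
  rintro ⟨u, v⟩ hp
  have := mem_rect.1 hp
  exact mem_rect.2 ⟨by omega, this.2⟩

/-! ### Chains of minimal sets and life expectancy. -/

/-- `A` is contained in a minimal set with one more vertex. -/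
def HasSucc (A : Set (ℤ × ℤ)) : Prop :=
  ∃ C, IsMinimal C ∧ A ⊆ C ∧ C.ncard = A.ncard + 1

theorem pts_insert_ncard {S : Finset (ℤ × ℤ)} (hS : Lat S) {x : ℤ × ℤ} (hx : x ∉ S)
    (hxS : Lat (insert x S)) : (pts (insert x S)).ncard = (pts S).ncard + 1 := by
  rw [ncard_pts hS, ncard_pts hxS, Finset.card_insert_of_notMem hx]

theorem hasSucc_pts {S : Finset (ℤ × ℤ)} (hS : Lat S) :
    HasSucc (pts S) ↔ ∃ x ∉ S, MinF (insert x S) := by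
  constructor
  · rintro ⟨C, hC, hSC, hcard⟩
    obtain ⟨T, hT, rfl⟩ := exists_minF_of_isMinimal hC
    rw [pts_subset_pts hS] at hSC
    rw [ncard_pts hT.1, ncard_pts hS] at hcard
    obtain ⟨x, hx, rfl⟩ := (Finset.exists_eq_insert_iff (s := S) (t := T)).2 ⟨hSC, hcard.symm⟩
    exact ⟨x, hx, hT⟩
  · rintro ⟨x, hx, hmin⟩
    exact ⟨pts (insert x S), (isMinimal_pts hmin.1).2 hmin,
      (pts_subset_pts hS).2 (Finset.subset_insert _ _), pts_insert_ncard hS hx hmin.1⟩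

theorem isMinimal_enc {A : Set (ℤ × ℤ)} (hA : IsMinimal A) (hne : A.Nonempty) :
    IsMinimal (enc A) := by
  obtain ⟨S, hS, rfl⟩ := exists_minF_of_isMinimal hA
  obtain ⟨a, b, c, d, hB⟩ := exists_bounds (nonempty_of_nonempty_pts hne)
  rw [enc_pts hS.1 hB, isMinimal_pts (lat_rect _ _ _ _)]
  exact (hS.rect hB).1

theorem subset_enc {A : Set (ℤ × ℤ)} : A ⊆ enc A := Set.subset_sInter fun _ h => h.2

theorem enc_eq_of_subset_of_subset {A A' : Set (ℤ × ℤ)} (hA : A.Finite) (hne : A.Nonempty)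
    (h : A ⊆ A') (h' : A' ⊆ enc A) : enc A' = enc A := by
  apply Set.Subset.antisymm
  · exact Set.sInter_subset_of_mem ⟨(isLeast_enc hA hne).1.1, h'⟩
  · exact Set.subset_sInter fun B hB => Set.sInter_subset_of_mem ⟨hB.1, h.trans hB.2⟩

theorem hasSucc_enc_of_not_subset {A A' : Set (ℤ × ℤ)} (hA : IsMinimal A) (hne : A.Nonempty)
    (hA' : IsMinimal A') (hsub : A ⊆ A') (hcard : A'.ncard = A.ncard + 1)
    (hnot : ¬ A' ⊆ enc A) : HasSucc (enc A) := by
  obtain ⟨S, hS, rfl⟩ := exists_minF_of_isMinimal hA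
  obtain ⟨T, hT, rfl⟩ := exists_minF_of_isMinimal hA'
  obtain ⟨a, b, c, d, hB⟩ := exists_bounds (nonempty_of_nonempty_pts hne)
  rw [pts_subset_pts hS.1] at hsub
  rw [ncard_pts hT.1, ncard_pts hS.1] at hcard
  obtain ⟨x, hx, rfl⟩ := (Finset.exists_eq_insert_iff (s := S) (t := T)).2 ⟨hsub, hcard.symm⟩
  rw [enc_pts hS.1 hB] at hnot ⊢
  rw [pts_subset_pts hT.1] at hnot
  have hxr : x ∉ rect a b c d := fun h =>
    hnot (Finset.insert_subset h (hB.subset_rect hS.1))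
  exact (hasSucc_pts (lat_rect _ _ _ _)).2 ⟨x, hxr, hS.insert_boundingRect hB hxr hT⟩

/-- Extendability of the enclosing box is preserved by a suitable one-point step: inside the box the
enclosing box is unchanged, and a full box uses `exists_insert_rect_not_dead`. -/
theorem exists_succ_hasSucc_enc {A : Set (ℤ × ℤ)} (hA : IsMinimal A) (hne : A.Nonempty)
    (h : HasSucc (enc A)) : ∃ A', IsMinimal A' ∧ A ⊆ A' ∧ A'.ncard = A.ncard + 1 ∧
      HasSucc (enc A') := by
  obtain ⟨S, hS, rfl⟩ := exists_minF_of_isMinimal hA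
  obtain ⟨a, b, c, d, hB⟩ := exists_bounds (nonempty_of_nonempty_pts hne)
  rw [enc_pts hS.1 hB] at h
  by_cases hSr : S = rect a b c d
  · subst hSr
    obtain ⟨x, hx, hxmin⟩ := (hasSucc_pts hS.1).1 h
    obtain ⟨y, hy, hymin, a', b', c', d', hB', hz⟩ := exists_insert_rect_not_dead hB hS hx hxmin
    refine ⟨pts (insert y (rect a b c d)), (isMinimal_pts hymin.1).2 hymin,
      (pts_subset_pts hS.1).2 (Finset.subset_insert _ _), pts_insert_ncard hS.1 hy hymin.1, ?_⟩
    rw [enc_pts hymin.1 hB']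
    exact (hasSucc_pts (lat_rect _ _ _ _)).2 hz
  · obtain ⟨x, hx, hxS, hmin, -⟩ := hS.exists_minF_insert hB hSr
    refine ⟨pts (insert x S), (isMinimal_pts hmin.1).2 hmin,
      (pts_subset_pts hS.1).2 (Finset.subset_insert _ _), pts_insert_ncard hS.1 hxS hmin.1, ?_⟩
    rw [enc_pts hmin.1 (hB.insert hx)]
    exact h

theorem hasMinimalChain_of_hasSucc_enc {A : Set (ℤ × ℤ)} (hA : IsMinimal A) (hne : A.Nonempty)
    (h : HasSucc (enc A)) (n : ℕ) : HasMinimalChain A n := by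
  have step : ∀ B : {B : Set (ℤ × ℤ) // IsMinimal B ∧ B.Nonempty ∧ HasSucc (enc B)},
      ∃ C : {B : Set (ℤ × ℤ) // IsMinimal B ∧ B.Nonempty ∧ HasSucc (enc B)},
        B.1 ⊆ C.1 ∧ C.1.ncard = B.1.ncard + 1 := by
    rintro ⟨B, hB, hBne, hBs⟩
    obtain ⟨C, hC, hBC, hcard, hCs⟩ := exists_succ_hasSucc_enc hB hBne hBs
    exact ⟨⟨C, hC, hBne.mono hBC, hCs⟩, hBC, hcard⟩
  choose f hf using step
  let T : ℕ → {B : Set (ℤ × ℤ) // IsMinimal B ∧ B.Nonempty ∧ HasSucc (enc B)} :=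
    fun i => f^[i] ⟨A, hA, hne, h⟩
  have hT : ∀ i, T (i + 1) = f (T i) := fun i => Function.iterate_succ_apply' f i _
  refine ⟨fun i => (T i).1, rfl, fun i _ => ⟨(T i).2.1, ?_⟩, fun i _ => ?_⟩
  · induction i with
    | zero => rfl
    | succ i ih =>
      have := ih (by omega)
      beta_reduce at this ⊢
      rw [hT, (hf _).2, this]
      ring
  · beta_reduce
    rw [hT]
    exact (hf _).1

theorem le_lifeExpectancy {A : Set (ℤ × ℤ)} {n : ℕ} (h : HasMinimalChain A n) :
    (n : ℕ∞) ≤ lifeExpectancy A :=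
  le_iSup₂_of_le n h le_rfl

theorem hasMinimalChain_one {A : Set (ℤ × ℤ)} (hA : IsMinimal A) (h : HasSucc A) :
    HasMinimalChain A 1 := by
  obtain ⟨C, hC, hAC, hcard⟩ := h
  refine ⟨fun i => if i = 0 then A else C, by simp, fun i hi => ?_, fun i hi => ?_⟩
  · have : i = 0 ∨ i = 1 := by omega
    rcases this with rfl | rfl
    · simpa using hA
    · simpa using ⟨hC, hcard⟩
  · obtain rfl : i = 0 := by omega
    simpa using hAC

theorem isDead_iff {A : Set (ℤ × ℤ)} (hA : IsMinimal A) : IsDead A ↔ ¬ HasSucc A := by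
  constructor
  · rintro ⟨-, h⟩ hs
    have := le_lifeExpectancy (hasMinimalChain_one hA hs)
    rw [h] at this
    simp at this
  · intro h
    refine ⟨hA, le_antisymm (iSup₂_le fun n hn => ?_) bot_le⟩
    rcases n with _ | n
    · simp
    · obtain ⟨S, h0, h1, h2⟩ := hn
      refine absurd ⟨S 1, (h1 1 (by omega)).1, ?_, (h1 1 (by omega)).2⟩ h
      rw [← h0]
      exact h2 0 (by omega)

/-- As long as the chain stays inside, its sets have enclosing box `enc A`; the first set to leave
would yield an extension of that box. -/
theorem chain_subset_enc {A : Set (ℤ × ℤ)} (hne : A.Nonempty) (h : ¬ HasSucc (enc A)) {n : ℕ}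
    {S : ℕ → Set (ℤ × ℤ)} (h0 : S 0 = A)
    (h1 : ∀ i ≤ n, IsMinimal (S i) ∧ (S i).ncard = A.ncard + i) (h2 : ∀ i < n, S i ⊆ S (i + 1))
    {i : ℕ} (hi : i ≤ n) : A ⊆ S i ∧ S i ⊆ enc A := by
  induction i with
  | zero => exact ⟨h0.ge, h0.le.trans subset_enc⟩
  | succ i ih =>
    obtain ⟨ih1, ih2⟩ := ih (by omega)
    have hfin : A.Finite := h0 ▸ (h1 0 (by omega)).1.1
    have henc := enc_eq_of_subset_of_subset hfin hne ih1 ih2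
    refine ⟨ih1.trans (h2 i (by omega)), ?_⟩
    by_contra hnot
    rw [← henc] at h hnot
    have e1 := h1 i (by omega)
    have e2 := h1 (i + 1) hi
    exact h (hasSucc_enc_of_not_subset e1.1 (hne.mono ih1) e2.1 (h2 i (by omega)) (by omega) hnot)

theorem lifeExpectancy_lt_top {A : Set (ℤ × ℤ)} (hA : IsMinimal A) (hne : A.Nonempty)
    (h : ¬ HasSucc (enc A)) : lifeExpectancy A < ⊤ := by
  refine lt_of_le_of_lt (iSup₂_le fun n hn => ?_) (ENat.natCast_lt_top (enc A).ncard)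
  obtain ⟨S, h0, h1, h2⟩ := hn
  have h3 := Set.ncard_le_ncard (chain_subset_enc hne h h0 h1 h2 le_rfl).2
    (isMinimal_enc hA hne).1
  have := (h1 n le_rfl).2
  exact_mod_cast (by omega : n ≤ (enc A).ncard)

end PlanarIso

theorem mainTheorem6 (A : Set (ℤ × ℤ)) (hA : PlanarIso.IsMinimal A) (hne : A.Nonempty) :
    PlanarIso.IsMinimal (PlanarIso.enc A) ∧
      (PlanarIso.IsMortal A ↔ PlanarIso.IsDead (PlanarIso.enc A)) := by
  have henc := PlanarIso.isMinimal_enc hA hne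
  refine ⟨henc, ?_⟩
  rw [PlanarIso.isDead_iff henc]
  constructor
  · rintro ⟨-, hlt⟩ hs
    refine hlt.ne (ENat.eq_top_iff_forall_ge.2 fun n => ?_)
    exact PlanarIso.le_lifeExpectancy (PlanarIso.hasMinimalChain_of_hasSucc_enc hA hne hs n)
  · exact fun h => ⟨hA, PlanarIso.lifeExpectancy_lt_top hA hne h⟩
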